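/- Let $H$ be a Hermitian $N\times N$ matrix ($N\ge 1$) with eigenvalues $E_0\le\dots\le E_{N-1}$, let $a\in\mathbb R\setminus[E_0,E_{N-1}]$, and put $R(a)=(a-H)^{-1}$, $a^{+}=\max_n|a-E_n|$, $a^{-}=\min_n|a-E_n|$. Let $0<\epsilon\le 1/a^{-}=\|R(a)\|_2$, and put $$q^{\max}=\frac{2}{a^-}\sqrt{\log\frac{4}{\epsilon a^-}},\qquad y^{\max}=\sqrt{2\log\frac{4}{\epsilon a^-}} .$$ For integers $L_q\ge 1$, $L_y\ge 2$, truncate the integral $R(a)=\frac1\pi\,\mathrm{sgn}(a-E_0)\int_0^\infty dq\int_{-\infty}^\infty dy\,e^{-y^2/2}e^{iy(a-H)q}$ to $[0,q^{\max}]\times[-y^{\max},y^{\max}]$ and discretize it by the $L_q$-point Gauss–Legendre rule in $q$ (nodes $q_j=q^{\max}(1+x_j)/2$, weights $\frac{q^{\max}}{2}w_j$, where $x_j$ are the roots of the Legendre polynomial of degree $L_q$ and $w_j$ the Gauss–Legendre weights on $[-1,1]$) and the trapezoidal rule $y_\ell=(\ell-\frac{L_y-1}{2})\Delta y$, $0\le\ell\le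 L_y-1$, with uniform weight $\Delta y=\frac{2y^{\max}}{L_y-1}$, in $y$. This yields the linear combination of $L_qL_y$ time evolutions $$\mathcal I=\frac1\pi\,\mathrm{sgn}(a-E_0)\sum_{\ell,j}\Delta y\,e^{-y_\ell^2/2}\,\frac{q^{\max}}{2}w_j\,e^{ia t_{j\ell}}\,e^{-iHt_{j\ell}},\qquad t_{j\ell}=y_\ell q_j .$$ Define $$J=\Big[\log\frac{32e^{\pi}}{\sqrt\pi\,\epsilon^2a^+a^-}+\frac{2\sqrt2\,a^+}{a^-}\log\frac{4}{\epsilon a^-}\Big]\Big[\log_2\frac{\sqrt2}{\pi\epsilon a^-}+\frac{a^+}{2a^-}\log_2\frac{4}{\epsilon a^-}+7\Big],$$ $$T^{\max}=\frac{2\sqrt2}{a^-}\log\frac{4}{\epsilon a^-},\qquad T^{\rm tot}=\frac{\sqrt2\,J}{2a^-}\log\frac{4}{\epsilon a^-}.$$ Then $L_q$ and $L_y$ can be chosen, depending only on $a^+$, $a^-$ and $\epsilon$, such that for every $\epsilon\in(0,1/a^-]$ $$\|R(a)-\mathcal I\|_2<\epsilon,\qquad L_qL_y\le J,\qquad \max_{j,\ell}|t_{j\ell}|\le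 T^{\max},\qquad \sum_{j,\ell}|t_{j\ell}|\le T^{\rm tot},$$ and such that, for fixed $a$ and $H$, the last three bounds are equalities to leading order: the ratio of the left side to the right side of each tends to $1$ as $\epsilon\to0^+$. -/

import Mathlib

open Filter Topology
open scoped Matrix.Norms.L2Operator

noncomputable section

namespace RealPoleLCU

/-! ### Spectral data of a Hermitian matrix, relative to a real pole -/

/-- The smallest eigenvalue `E₀`. -/
def minEig {N : ℕ} {H : Matrix (Fin N) (Fin N) ℂ} (hH : H.IsHermitian) : ℝ :=
  ⨅ n, hH.eigenvalues n

/-- The largest eigenvalue `E_{N-1}`. -/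
def maxEig {N : ℕ} {H : Matrix (Fin N) (Fin N) ℂ} (hH : H.IsHermitian) : ℝ :=
  ⨆ n, hH.eigenvalues n

/-- `a⁺ = max_n |a - E_n|`. -/
def aPlus {N : ℕ} {H : Matrix (Fin N) (Fin N) ℂ} (hH : H.IsHermitian) (a : ℝ) : ℝ :=
  ⨆ n, |a - hH.eigenvalues n|

/-- `a⁻ = min_n |a - E_n|`. -/
def aMinus {N : ℕ} {H : Matrix (Fin N) (Fin N) ℂ} (hH : H.IsHermitian) (a : ℝ) : ℝ :=
  ⨅ n, |a - hH.eigenvalues n|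

/-- The resolvent `R(a) = (a - H)⁻¹`. -/
def resolventAt {N : ℕ} (H : Matrix (Fin N) (Fin N) ℂ) (a : ℝ) : Matrix (Fin N) (Fin N) ℂ :=
  ((a : ℂ) • (1 : Matrix (Fin N) (Fin N) ℂ) - H)⁻¹

/-- The time evolution `e^{-iHt}`. -/
def evolution {N : ℕ} (H : Matrix (Fin N) (Fin N) ℂ) (t : ℝ) : Matrix (Fin N) (Fin N) ℂ :=
  NormedSpace.exp ((-(Complex.I * (t : ℂ))) • H)

/-! ### The Gauss–Legendre rule on `[-1, 1]` -/

/-- The Legendre polynomial `P_n = (2ⁿ n!)⁻¹ (d/dx)ⁿ (x² - 1)ⁿ`. -/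
def legendre (n : ℕ) : Polynomial ℝ :=
  Polynomial.C (((2 : ℝ) ^ n * (n.factorial : ℝ))⁻¹) *
    (Polynomial.derivative^[n] ((Polynomial.X ^ 2 - 1) ^ n))

/-- The nodes of the `n`-point Gauss–Legendre rule: the roots of `P_n`. -/
def legendreNodes (n : ℕ) : Finset ℝ := (legendre n).roots.toFinset

/-- The weight of the `n`-point Gauss–Legendre rule at the node `x`: the integral over `[-1, 1]`
of the Lagrange basis polynomial of the nodes that belongs to `x`. -/
def legendreWeight (n : ℕ) (x : ℝ) : ℝ :=
  ∫ t in (-1 : ℝ)..1, (Lagrange.basis (legendreNodes n) id x).eval t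

/-! ### The truncated and discretized double integral

The resolvent at a real pole `a` outside `[E₀, E_{N-1}]` is
`(1/π) sgn(a - E₀) ∫_0^∞ dq ∫_{-∞}^∞ dy e^{-y²/2} e^{iy(a-H)q}`.
The integral is restricted to `0 ≤ q ≤ qMax`, `|y| ≤ yMax`. -/

/-- Truncation of the `q`-integral: `(2 / a⁻) √(log (4 / (ε a⁻)))`. -/
def qMax (am ε : ℝ) : ℝ := 2 / am * √(Real.log (4 / (ε * am)))

/-- Truncation of the `y`-integral: `√(2 log (4 / (ε a⁻)))`. At `y = ± yMax` the Gaussian factor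
`e^{-y²/2}` equals `ε a⁻ / 4`. -/
def yMax (am ε : ℝ) : ℝ := √(2 * Real.log (4 / (ε * am)))

/-- The step `Δy = 2 yMax / (Ly - 1)` of the trapezoidal rule with `Ly` nodes. -/
def yStep (am ε : ℝ) (Ly : ℕ) : ℝ := 2 * yMax am ε / ((Ly : ℝ) - 1)

/-- The trapezoidal nodes `y_ℓ = (ℓ - (Ly - 1) / 2) Δy`, `0 ≤ ℓ ≤ Ly - 1`. -/
def yNode (am ε : ℝ) (Ly ℓ : ℕ) : ℝ := ((ℓ : ℝ) - ((Ly : ℝ) - 1) / 2) * yStep am ε Ly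

/-- The image in `[0, qMax]` of the point `x` of `[-1, 1]`. -/
def qNode (am ε x : ℝ) : ℝ := qMax am ε * (1 + x) / 2

/-- The index set of the product rule: pairs of a Gauss–Legendre node in `[-1, 1]` and the number
of a trapezoidal node. -/
def grid (Lq Ly : ℕ) : Finset (ℝ × ℕ) := legendreNodes Lq ×ˢ Finset.range Ly

/-- The evolution time `t = y q` that belongs to a grid point. -/
def time (am ε : ℝ) (Ly : ℕ) (p : ℝ × ℕ) : ℝ := yNode am ε Ly p.2 * qNode am ε p.1

/-- The coefficient of `e^{-iHt}` that belongs to a grid point, for the pole `a`: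
`(1/π) sgn(a - E₀) · Δy e^{-y²/2} · (qMax / 2) w · e^{iat}`, with `w` the Gauss–Legendre weight. -/
def coeff {N : ℕ} {H : Matrix (Fin N) (Fin N) ℂ} (hH : H.IsHermitian) (a ε : ℝ) (Lq Ly : ℕ)
    (p : ℝ × ℕ) : ℂ :=
  ((1 / Real.pi * Real.sign (a - minEig hH) *
      (yStep (aMinus hH a) ε Ly * Real.exp (-(yNode (aMinus hH a) ε Ly p.2) ^ 2 / 2)) *
      (qMax (aMinus hH a) ε / 2 * legendreWeight Lq p.1) : ℝ) : ℂ) *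
    Complex.exp (Complex.I * ((a * time (aMinus hH a) ε Ly p : ℝ) : ℂ))

/-- The linear combination of real-time evolutions given by the Gauss–Legendre rule in `q` and the
trapezoidal rule in `y`. -/
def lcu {N : ℕ} {H : Matrix (Fin N) (Fin N) ℂ} (hH : H.IsHermitian) (a ε : ℝ) (Lq Ly : ℕ) :
    Matrix (Fin N) (Fin N) ℂ :=
  ∑ p ∈ grid Lq Ly, coeff hH a ε Lq Ly p • evolution H (time (aMinus hH a) ε Ly p)

/-- The number of time evolutions in the linear combination. -/
def gridCard (Lq Ly : ℕ) : ℝ := ((grid Lq Ly).card : ℝ)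

/-- `‖t‖_∞`, the largest evolution time in absolute value. -/
def timeSup (am ε : ℝ) (Lq Ly : ℕ) : ℝ :=
  (((grid Lq Ly).sup fun p => ‖time am ε Ly p‖₊ : NNReal) : ℝ)

/-- `‖t‖_1`, the sum of the absolute values of all evolution times. -/
def timeSum (am ε : ℝ) (Lq Ly : ℕ) : ℝ := ∑ p ∈ grid Lq Ly, |time am ε Ly p|

/-! ### The predicted cost -/

/-- The predicted number `J` of time evolutions. -/
def costJ (ap am ε : ℝ) : ℝ :=
  (Real.log (32 * Real.exp Real.pi / (√Real.pi * ε ^ 2 * ap * am))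
      + 2 * √2 * ap / am * Real.log (4 / (ε * am))) *
    (Real.logb 2 (√2 / (Real.pi * ε * am))
      + ap / (2 * am) * Real.logb 2 (4 / (ε * am)) + 7)

/-- The predicted maximal evolution time. -/
def costTmax (am ε : ℝ) : ℝ := 2 * √2 / am * Real.log (4 / (ε * am))

/-- The predicted total evolution time. -/
def costTtot (ap am ε : ℝ) : ℝ :=
  √2 * costJ ap am ε / (2 * am) * Real.log (4 / (ε * am))

end RealPoleLCU

end

/-! Let `L = log (4 / (ε a⁻))` and `κ = a⁺ / a⁻`. In an eigenbasis of `H` the operator error is the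
maximum over eigenvalues of a scalar error for `1 / |x|`, with `x = a - E_n` and `a⁻ ≤ |x| ≤ a⁺`
(`norm_inv_abs_sub_sum_grid_lt`). That error has three sources. (i) The `n`-point Gauss–Legendre
rule is exact in degree below `2 n`, so on the oscillation in `q` it errs by a Taylor remainder `c ^
(2 n) / (2 n)!` with `c ≤ √2 κ L`; this is at most `exp (-4 L)` once `n ≥ 2 (κ + 1) L`. (ii) Poisson
summation turns the trapezoidal sum in `y` into the exact Gaussian plus aliases. The aliases are
harmless when the step is small, and the truncation in `y` costs a multiple of `exp (-L) = ε a⁻ /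
4`. (iii) Cutting `q` off costs a Gaussian tail `exp (-2 L)`. Together these stay below `π ε`
(`error_budget_lt`), which the prefactor `1 / π` turns into `ε`.

For the costs, `Ly = 2 K + 1` with the least `K` allowed by (ii), and `Lq = ⌊J / (2 K + 2)⌋` spends
the whole budget `J`. The accuracy claim then rests on `costJ_ge`: the budget leaves enough Gauss
nodes for (i). Since the Legendre nodes are symmetric, the sum of the `|t|` is exactly `Lq (2 K + 2)
Tmax / 4`, while `Ttot = J Tmax / 4`; so the bounds on number and total time hold, and are sharp
because `⌊z⌋ / z → 1`. The maximal time is sharp because the largest Gauss–Legendre node tends to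
`1` (`exists_legendreNode_pow_ge`). -/

namespace RealPoleLCU

/-! ### Legendre polynomials: real roots, orthogonality, location of the nodes -/

open Polynomial in
theorem natDegree_iterate_derivative_sq_sub_one (n k : ℕ) :
    (derivative^[k] ((X ^ 2 - 1 : ℝ[X]) ^ n)).natDegree = 2 * n - k := by
  have h0 : ((X ^ 2 - 1 : ℝ[X]) ^ n).natDegree = 2 * n := by
    rw [natDegree_pow]
    have : (X ^ 2 - 1 : ℝ[X]).natDegree = 2 := by
      simpa using natDegree_X_pow_sub_C (n := 2) (r := (1 : ℝ))
    rw [this, mul_comm]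
  induction k with
  | zero => simpa using h0
  | succ k ih =>
    rw [Function.iterate_succ_apply', natDegree_derivative, ih]
    omega

open Polynomial in
theorem iterate_derivative_sq_sub_one_ne_zero {n k : ℕ} (hk : k ≤ n) :
    derivative^[k] ((X ^ 2 - 1 : ℝ[X]) ^ n) ≠ 0 := by
  intro h
  have h1 := natDegree_iterate_derivative_sq_sub_one n k
  rw [h, natDegree_zero] at h1
  obtain rfl : n = 0 := by omega
  obtain rfl : k = 0 := by omega
  simp at h

open Polynomial in
theorem eval_iterate_derivative_sq_sub_one {n k : ℕ} (hk : k < n) {x : ℝ} (hx : x ^ 2 = 1) :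
    (derivative^[k] ((X ^ 2 - 1 : ℝ[X]) ^ n)).eval x = 0 := by
  obtain ⟨q, hq⟩ := pow_sub_dvd_iterate_derivative_pow (X ^ 2 - 1 : ℝ[X]) n k
  rw [hq, eval_mul, eval_pow]
  simp [hx, Nat.sub_ne_zero_of_lt hk]

open Polynomial in
-- Rolle's theorem, iterated: `m` distinct roots yield `m - 1` new ones strictly between them, and
-- `±1` remain roots as long as `k < n`, so each derivative gains one root.
theorem card_roots_iterate_derivative_sq_sub_one {n k : ℕ} (hk : k < n) :
    k + 2 ≤ (derivative^[k] ((X ^ 2 - 1 : ℝ[X]) ^ n)).roots.toFinset.card := by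
  have hmem : ∀ k, k < n → ∀ x : ℝ, x ^ 2 = 1 →
      x ∈ (derivative^[k] ((X ^ 2 - 1 : ℝ[X]) ^ n)).roots.toFinset := fun k hk x hx => by
    rw [Multiset.mem_toFinset, mem_roots (iterate_derivative_sq_sub_one_ne_zero hk.le)]
    exact eval_iterate_derivative_sq_sub_one hk hx
  have hpair : ({1, -1} : Finset ℝ).card = 2 := Finset.card_pair (by norm_num)
  have hsub : ∀ k, k < n →
      ({1, -1} : Finset ℝ) ⊆ (derivative^[k] ((X ^ 2 - 1 : ℝ[X]) ^ n)).roots.toFinset := by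
    intro k hk x hx
    refine hmem k hk x ?_
    rcases Finset.mem_insert.1 hx with rfl | hx
    · norm_num
    · rw [Finset.mem_singleton.1 hx]; norm_num
  induction k with
  | zero => exact hpair.symm.le.trans (Finset.card_le_card (hsub 0 hk))
  | succ k ih =>
    have h1 := ih (by omega)
    have h2 := card_roots_toFinset_le_card_roots_derivative_sdiff_roots_succ
      (derivative^[k] ((X ^ 2 - 1 : ℝ[X]) ^ n))
    rw [← Function.iterate_succ_apply' (f := derivative), Nat.succ_eq_add_one] at h2
    have hdisj : Disjoint
        ((derivative^[k + 1] ((X ^ 2 - 1 : ℝ[X]) ^ n)).roots.toFinset \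
          (derivative^[k] ((X ^ 2 - 1 : ℝ[X]) ^ n)).roots.toFinset) ({1, -1} : Finset ℝ) :=
      Finset.disjoint_of_subset_right (hsub k (by omega)) Finset.sdiff_disjoint
    have h3 := Finset.card_le_card
      (Finset.union_subset (Finset.sdiff_subset (s :=
        (derivative^[k + 1] ((X ^ 2 - 1 : ℝ[X]) ^ n)).roots.toFinset)
        (t := (derivative^[k] ((X ^ 2 - 1 : ℝ[X]) ^ n)).roots.toFinset)) (hsub (k + 1) hk))
    rw [Finset.card_union_of_disjoint hdisj, hpair] at h3
    omega

open Polynomial in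
theorem natDegree_legendre (n : ℕ) : (legendre n).natDegree = n := by
  rw [legendre, natDegree_C_mul (by positivity), natDegree_iterate_derivative_sq_sub_one]
  omega

theorem legendre_ne_zero (n : ℕ) : legendre n ≠ 0 :=
  mul_ne_zero (Polynomial.C_ne_zero.2 (by positivity))
    (iterate_derivative_sq_sub_one_ne_zero le_rfl)

theorem mem_legendreNodes {n : ℕ} {x : ℝ} : x ∈ legendreNodes n ↔ (legendre n).eval x = 0 := by
  rw [legendreNodes, Multiset.mem_toFinset, Polynomial.mem_roots (legendre_ne_zero n),
    Polynomial.IsRoot]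

open Polynomial in
/-- The Legendre polynomial of degree `n` has `n` distinct real roots. -/
theorem card_legendreNodes (n : ℕ) : (legendreNodes n).card = n := by
  apply le_antisymm
  · calc _ ≤ Multiset.card (legendre n).roots := Multiset.toFinset_card_le _
      _ ≤ (legendre n).natDegree := card_roots' _
      _ = n := natDegree_legendre n
  · rcases n with _ | n
    · exact Nat.zero_le _
    rw [legendreNodes, legendre, roots_C_mul _ (by positivity)]
    have h1 := card_roots_iterate_derivative_sq_sub_one (Nat.lt_add_one n)
    have h2 := card_roots_toFinset_le_derivative (derivative^[n] ((X ^ 2 - 1 : ℝ[X]) ^ (n + 1)))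
    rw [← Function.iterate_succ_apply' (f := derivative), Nat.succ_eq_add_one] at h2
    omega

open Polynomial in
-- Integration by parts `j` times. The boundary terms vanish because derivatives of order below `n`
-- of `(x² - 1)ⁿ` are zero at `±1`.
theorem integral_iterate_derivative_mul (n : ℕ) {j : ℕ} (hj : j ≤ n) (q : ℝ[X]) :
    ∫ t in (-1 : ℝ)..1, (derivative^[n] ((X ^ 2 - 1 : ℝ[X]) ^ n)).eval t * q.eval t =
      (-1) ^ j * ∫ t in (-1 : ℝ)..1,
        (derivative^[n - j] ((X ^ 2 - 1 : ℝ[X]) ^ n)).eval t * (derivative^[j] q).eval t := by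
  induction j with
  | zero => simp
  | succ j ih =>
    rw [ih (by omega)]
    obtain ⟨m, hm⟩ : ∃ m, n - j = m + 1 := ⟨n - j - 1, by omega⟩
    have hm' : n - (j + 1) = m := by omega
    have hmn : m < n := by omega
    rw [hm, hm', Function.iterate_succ_apply', Function.iterate_succ_apply']
    have h := intervalIntegral.integral_deriv_mul_eq_sub (a := (-1 : ℝ)) (b := 1)
      (fun x _ => (derivative^[m] ((X ^ 2 - 1 : ℝ[X]) ^ n)).hasDerivAt x)
      (fun x _ => (derivative^[j] q).hasDerivAt x)
      ((Polynomial.continuous _).intervalIntegrable _ _)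
      ((Polynomial.continuous _).intervalIntegrable _ _)
    rw [eval_iterate_derivative_sq_sub_one hmn (by norm_num),
      eval_iterate_derivative_sq_sub_one hmn (by norm_num),
      intervalIntegral.integral_add (Continuous.intervalIntegrable (by fun_prop) _ _)
        (Continuous.intervalIntegrable (by fun_prop) _ _)] at h
    rw [pow_succ (-1 : ℝ) j]
    linear_combination (-1) ^ j * h

open Polynomial in
/-- The Legendre polynomial is orthogonal to all polynomials of smaller degree. -/
theorem integral_legendre_mul {n : ℕ} {q : ℝ[X]} (hq : q.degree < n) :
    ∫ t in (-1 : ℝ)..1, (legendre n * q).eval t = 0 := by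
  have h := integral_iterate_derivative_mul n le_rfl q
  rw [iterate_derivative_eq_zero_of_degree_lt hq] at h
  simp only [eval_zero, mul_zero, intervalIntegral.integral_zero] at h
  simp only [legendre, eval_mul, eval_C, mul_assoc]
  rw [intervalIntegral.integral_const_mul, h, mul_zero]

open Polynomial in
theorem integral_mul_sq_pos {p q : ℝ[X]} (hq : q ≠ 0)
    (hp : ∀ t ∈ Set.Ioo (-1 : ℝ) 1, 0 < p.eval t) :
    0 < ∫ t in (-1 : ℝ)..1, (p * q ^ 2).eval t := by
  rw [intervalIntegral.integral_pos_iff_support_of_nonneg_ae']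
  · refine ⟨by norm_num, ?_⟩
    have hsub : Set.Ioo (-1 : ℝ) 1 \ (q.roots.toFinset : Set ℝ) ⊆
        (Function.support fun t => (p * q ^ 2).eval t) ∩ Set.Ioc (-1) 1 := by
      rintro t ⟨ht, htq⟩
      refine ⟨?_, ht.1, ht.2.le⟩
      have : q.eval t ≠ 0 := fun h => htq (by simp [hq, h])
      simp only [Function.mem_support, eval_mul, eval_pow]
      exact mul_ne_zero (hp t ht).ne' (pow_ne_zero _ this)
    refine lt_of_lt_of_le ?_ (MeasureTheory.measure_mono hsub)
    rw [MeasureTheory.measure_sdiff_null (Finset.measure_zero _ _)]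
    simp
  · rw [Set.uIoc_of_le (by norm_num)]
    have h1 : ∀ᵐ t ∂MeasureTheory.volume, t ≠ (1 : ℝ) := by
      simp [MeasureTheory.ae_iff, MeasureTheory.measure_singleton]
    rw [Filter.EventuallyLE, MeasureTheory.ae_restrict_iff' measurableSet_Ioc]
    filter_upwards [h1] with t ht1 ht
    simp only [eval_mul, eval_pow, Pi.zero_apply]
    exact mul_nonneg (hp t ⟨ht.1, lt_of_le_of_ne ht.2 ht1⟩).le (sq_nonneg _)
  · exact (Polynomial.continuous _).intervalIntegrable _ _

open Polynomial in
-- Write `P_n = (X - x) q` with `deg q < n`. If `x` were outside the open interval, `P_n q = (X - x)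
-- q²` would have constant sign there and a nonzero integral, against orthogonality.
theorem legendreNodes_mem_Ioo {n : ℕ} {x : ℝ} (hx : x ∈ legendreNodes n) :
    x ∈ Set.Ioo (-1 : ℝ) 1 := by
  obtain ⟨q, hq⟩ := dvd_iff_isRoot.2 (mem_legendreNodes.1 hx)
  have hq0 : q ≠ 0 := fun h => legendre_ne_zero n (by rw [hq, h, mul_zero])
  have hdeg : q.degree < n := by
    have h := natDegree_legendre n
    rw [hq, natDegree_mul (X_sub_C_ne_zero x) hq0, natDegree_X_sub_C] at h
    rw [degree_eq_natDegree hq0]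
    exact_mod_cast (by omega : q.natDegree < n)
  have horth := integral_legendre_mul hdeg
  by_contra hmem
  rw [Set.mem_Ioo, not_and_or, not_lt, not_lt] at hmem
  rcases hmem with h | h
  · have := integral_mul_sq_pos (p := X - C x) hq0 fun t ht => by
      simp only [eval_sub, eval_X, eval_C]; linarith [ht.1]
    rw [hq, show (X - C x) * q * q = (X - C x) * q ^ 2 by ring] at horth
    linarith
  · have := integral_mul_sq_pos (p := C x - X) hq0 fun t ht => by
      simp only [eval_sub, eval_X, eval_C]; linarith [ht.2]
    rw [hq, show (X - C x) * q * q = -((C x - X) * q ^ 2) by ring] at horth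
    simp only [eval_neg, intervalIntegral.integral_neg] at horth
    linarith

/-! ### The Gauss–Legendre rule: exactness, weights, symmetry, largest node -/

open Polynomial in
/-- The `n`-point Gauss–Legendre rule is exact in degree less than `2 n`. -/
theorem sum_legendreWeight_mul_eval {n : ℕ} {p : ℝ[X]} (hp : p.natDegree < 2 * n) :
    ∑ x ∈ legendreNodes n, legendreWeight n x * p.eval x = ∫ t in (-1 : ℝ)..1, p.eval t := by
  have hP := legendre_ne_zero n
  -- Division by `P_n`: the multiple of `P_n` has zero integral by orthogonality and vanishes at the
  -- nodes, while the remainder equals its own Lagrange interpolant.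
  have hdiv : legendre n * (p / legendre n) + p % legendre n = p := EuclideanDomain.div_add_mod _ _
  have hmod : (p % legendre n).degree < n := by
    have := degree_mod_lt p hP
    rwa [degree_eq_natDegree hP, natDegree_legendre] at this
  have hquot : (p / legendre n).degree < n := by
    by_cases h0 : p / legendre n = 0
    · rw [h0, degree_zero]; exact WithBot.bot_lt_coe _
    have h1 : (legendre n * (p / legendre n)).natDegree < 2 * n := by
      rw [eq_sub_of_add_eq hdiv]
      refine (natDegree_sub_le _ _).trans_lt (max_lt hp ?_)
      by_cases hm0 : p % legendre n = 0
      · rw [hm0, natDegree_zero]; omega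
      · have := (natDegree_lt_iff_degree_lt hm0).2 hmod
        omega
    rw [natDegree_mul hP h0, natDegree_legendre] at h1
    rw [degree_eq_natDegree h0]
    exact_mod_cast (by omega : (p / legendre n).natDegree < n)
  have hint : ∫ t in (-1 : ℝ)..1, p.eval t = ∫ t in (-1 : ℝ)..1, (p % legendre n).eval t := by
    conv_lhs => rw [← hdiv]
    simp only [eval_add]
    rw [intervalIntegral.integral_add ((Polynomial.continuous _).intervalIntegrable _ _)
      ((Polynomial.continuous _).intervalIntegrable _ _), integral_legendre_mul hquot, zero_add]
  have hinj : Set.InjOn (id : ℝ → ℝ) (legendreNodes n) := Function.injective_id.injOn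
  have hlag := Lagrange.eq_interpolate (s := legendreNodes n) (v := id) hinj
    (f := p % legendre n) (by rwa [card_legendreNodes])
  rw [hint]
  conv_rhs => rw [hlag]
  simp only [Lagrange.interpolate_apply, eval_finsetSum, eval_mul, eval_C, id]
  rw [intervalIntegral.integral_finsetSum]
  · refine Finset.sum_congr rfl fun x hx => ?_
    rw [intervalIntegral.integral_const_mul, legendreWeight, mul_comm]
    congr 1
    conv_lhs => rw [← hdiv]
    rw [eval_add, eval_mul, mem_legendreNodes.1 hx, zero_mul, zero_add]
  · intro x _
    exact (continuous_const.mul (Polynomial.continuous _)).intervalIntegrable _ _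

open Polynomial in
-- The square of the Lagrange basis polynomial has degree `2 n - 2`, so the rule is exact on it and
-- the weight equals the integral of a square.
theorem legendreWeight_nonneg {n : ℕ} {x : ℝ} (hx : x ∈ legendreNodes n) :
    0 ≤ legendreWeight n x := by
  have hinj : Set.InjOn (id : ℝ → ℝ) (legendreNodes n) := Function.injective_id.injOn
  have hn : 0 < n := by
    rw [← card_legendreNodes n]; exact Finset.card_pos.2 ⟨x, hx⟩
  have hdeg : ((Lagrange.basis (legendreNodes n) id x) ^ 2).natDegree < 2 * n := by
    rw [natDegree_pow, Lagrange.natDegree_basis hinj hx, card_legendreNodes]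
    omega
  have h := sum_legendreWeight_mul_eval hdeg
  rw [Finset.sum_eq_single_of_mem x hx] at h
  · have h1 := Lagrange.eval_basis_self hinj hx
    rw [id] at h1
    rw [eval_pow, h1, one_pow, mul_one] at h
    rw [h]
    refine intervalIntegral.integral_nonneg (by norm_num) fun t _ => ?_
    rw [eval_pow]; exact sq_nonneg _
  · intro y hy hyx
    have h1 := Lagrange.eval_basis_of_ne (v := id) (s := legendreNodes n) (i := x) hyx.symm hy
    rw [id] at h1
    rw [eval_pow, h1]; simp

theorem sum_legendreWeight {n : ℕ} (hn : 0 < n) :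
    ∑ x ∈ legendreNodes n, legendreWeight n x = 2 := by
  have h := sum_legendreWeight_mul_eval (n := n) (p := 1) (by simpa using hn)
  simp only [Polynomial.eval_one, mul_one, intervalIntegral.integral_const, smul_eq_mul] at h
  rw [h]; norm_num

open Polynomial in
theorem neg_mem_legendreNodes {n : ℕ} {x : ℝ} (hx : x ∈ legendreNodes n) :
    -x ∈ legendreNodes n := by
  have key : ∀ k (f : ℝ[X]), derivative^[k] (f.comp (-X)) =
      (-1) ^ k * (derivative^[k] f).comp (-X) := by
    intro k
    induction k with
    | zero => simp
    | succ k ih =>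
      intro f
      rw [Function.iterate_succ_apply, derivative_comp, derivative_neg, derivative_X,
        show (-1 : ℝ[X]) * (derivative f).comp (-X) = C (-1) * (derivative f).comp (-X) by simp,
        iterate_derivative_C_mul, ih, Function.iterate_succ_apply, pow_succ]
      simp
  have h := key n ((X ^ 2 - 1) ^ n)
  have hc : ((X ^ 2 - 1 : ℝ[X]) ^ n).comp (-X) = (X ^ 2 - 1) ^ n := by simp
  rw [hc] at h
  rw [mem_legendreNodes, legendre, eval_mul] at hx ⊢
  rw [h] at hx
  simp only [eval_mul, eval_pow, eval_neg, eval_one, eval_comp, eval_X] at hx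
  simpa using hx

theorem sum_legendreNodes (n : ℕ) : ∑ x ∈ legendreNodes n, x = 0 := by
  have h : ∑ x ∈ legendreNodes n, x = ∑ x ∈ legendreNodes n, -x :=
    Finset.sum_bij (fun x _ => -x) (fun x hx => neg_mem_legendreNodes hx)
      (fun _ _ _ _ h => neg_injective h)
      (fun x hx => ⟨-x, neg_mem_legendreNodes hx, neg_neg x⟩) (fun x _ => (neg_neg x).symm)
  rw [Finset.sum_neg_distrib] at h
  linarith

open Polynomial in
-- Shows that the largest node tends to `1`. The rule is exact on `((1 + x) / 2) ^ (2 n - 1)`, whose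
-- integral is `1 / n`; as the weights are nonnegative with sum `2`, some node has a value at least
-- the average `1 / (2 n)`.
theorem exists_legendreNode_pow_ge {n : ℕ} (hn : 0 < n) :
    ∃ x ∈ legendreNodes n, 1 / (2 * n : ℝ) ≤ ((1 + x) / 2) ^ (2 * n - 1) := by
  by_contra! hlt
  set p : ℝ[X] := (C (1 / 2) * (1 + X)) ^ (2 * n - 1) with hp
  have heval : ∀ t, p.eval t = ((1 + t) / 2) ^ (2 * n - 1) := by
    intro t; simp [hp]; ring
  have hdeg : p.natDegree < 2 * n := by
    have h1 : (C (1 / 2 : ℝ) * (1 + X)).natDegree ≤ 1 := by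
      compute_degree
    have : p.natDegree ≤ (2 * n - 1) * 1 := natDegree_pow_le_of_le (2 * n - 1) h1
    omega
  have hq := sum_legendreWeight_mul_eval hdeg
  simp only [heval] at hq
  have hint : ∫ t in (-1 : ℝ)..1, ((1 + t) / 2) ^ (2 * n - 1) = 1 / n := by
    have h1 := intervalIntegral.integral_comp_add_div (a := -1) (b := 1)
      (fun t : ℝ => t ^ (2 * n - 1)) (two_ne_zero) (1 / 2)
    have h2 : ∀ t : ℝ, (1 / 2 + t / 2) = (1 + t) / 2 := fun t => by ring
    simp only [h2] at h1
    rw [h1, integral_pow]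
    have h3 : 2 * n - 1 + 1 = 2 * n := by omega
    have h4 : ((2 * n - 1 : ℕ) : ℝ) + 1 = 2 * n := by exact_mod_cast h3
    rw [h4, h3, smul_eq_mul]
    have : (n : ℝ) ≠ 0 := by positivity
    field_simp
    norm_num [hn.ne']
  have hsum := sum_legendreWeight hn
  have hle : ∑ x ∈ legendreNodes n, legendreWeight n x * ((1 + x) / 2) ^ (2 * n - 1) <
      ∑ x ∈ legendreNodes n, legendreWeight n x * (1 / (2 * n : ℝ)) := by
    refine Finset.sum_lt_sum (fun x hx =>
      mul_le_mul_of_nonneg_left (hlt x hx).le (legendreWeight_nonneg hx)) ?_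
    obtain ⟨x, hx, hpos⟩ : ∃ x ∈ legendreNodes n, 0 < legendreWeight n x := by
      by_contra! h
      linarith [Finset.sum_nonpos h]
    exact ⟨x, hx, mul_lt_mul_of_pos_left (hlt x hx) hpos⟩
  rw [hq, hint, ← Finset.sum_mul, hsum] at hle
  have : (2 : ℝ) * (1 / (2 * n)) = 1 / n := by
    have : (n : ℝ) ≠ 0 := by positivity
    field_simp
  linarith

/-! ### Quadrature error for oscillating exponentials -/

/-- The derivative of the remainder of order `n + 1` is `i c` times the remainder of order `n`; the
bounds are related in the same way, so a mean value inequality gives the induction step. On the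
imaginary axis no factor `exp |c t|` appears. -/
theorem norm_exp_I_mul_sub_sum_le (c : ℝ) (n : ℕ) {t : ℝ} (ht : 0 ≤ t) :
    ‖Complex.exp (Complex.I * c * t) -
        ∑ k ∈ Finset.range n, (Complex.I * c * t) ^ k / (k.factorial : ℂ)‖ ≤
      |c| ^ n * t ^ n / n.factorial := by
  induction n generalizing t with
  | zero =>
    have : Complex.I * c * t = ((c * t : ℝ) : ℂ) * Complex.I := by push_cast; ring
    simp [this, Complex.norm_exp_ofReal_mul_I, -Complex.ofReal_mul]
  | succ n ih =>
    set f : ℕ → ℝ → ℂ := fun m t => Complex.exp (Complex.I * c * t) -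
        ∑ k ∈ Finset.range m, (Complex.I * c * t) ^ k / (k.factorial : ℂ) with hf
    have hlin : ∀ x : ℝ, HasDerivAt (fun t : ℝ => Complex.I * c * t) (Complex.I * c) x :=
      fun x => by simpa using (Complex.ofRealCLM.hasDerivAt (x := x)).const_mul (Complex.I * (c : ℂ))
    have hderiv : ∀ x : ℝ, HasDerivAt (f (n + 1)) (Complex.I * c * f n x) x := by
      intro x
      have h1 := (hlin x).cexp
      have h2 : HasDerivAt (fun t : ℝ => ∑ k ∈ Finset.range (n + 1),
          (Complex.I * c * t) ^ k / (k.factorial : ℂ))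
          (∑ k ∈ Finset.range (n + 1),
            ((k : ℂ) * (Complex.I * c * x) ^ (k - 1) * (Complex.I * c)) / (k.factorial : ℂ)) x :=
        HasDerivAt.fun_sum fun k _ => ((hlin x).fun_pow k).div_const _
      refine (h1.sub h2).congr_deriv ?_
      rw [Finset.sum_range_succ', hf]
      simp only [Nat.cast_zero, zero_mul, zero_div, add_zero, mul_sub, Finset.mul_sum]
      congr 1
      · ring
      · refine Finset.sum_congr rfl fun k _ => ?_
        rw [Nat.factorial_succ, Nat.add_sub_cancel]
        have : (k.factorial : ℂ) ≠ 0 := by exact_mod_cast k.factorial_ne_zero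
        have : ((k : ℂ) + 1) ≠ 0 := by exact_mod_cast k.succ_ne_zero
        push_cast
        field_simp
    have hB : ∀ x : ℝ, HasDerivAt (fun t : ℝ => |c| ^ (n + 1) * t ^ (n + 1) / (n + 1).factorial)
        (|c| * (|c| ^ n * x ^ n / n.factorial)) x := by
      intro x
      refine (((hasDerivAt_pow (n + 1) x).const_mul (|c| ^ (n + 1))).div_const _).congr_deriv ?_
      rw [Nat.factorial_succ, Nat.add_sub_cancel]
      have : (n.factorial : ℝ) ≠ 0 := by positivity
      push_cast
      field_simp
      ring
    refine image_norm_le_of_norm_deriv_right_le_deriv_boundary (f := f (n + 1)) (a := 0) (b := t)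
      (fun x _ => (hderiv x).continuousAt.continuousWithinAt)
      (fun x _ => (hderiv x).hasDerivWithinAt) (B := fun t => |c| ^ (n + 1) * t ^ (n + 1) /
        (n + 1).factorial) ?_ hB ?_ (Set.right_mem_Icc.2 ht)
    · simp [hf, Finset.sum_range_succ']
    · intro x hx
      rw [norm_mul, norm_mul, Complex.norm_I, one_mul, Complex.norm_real, Real.norm_eq_abs]
      exact mul_le_mul_of_nonneg_left (ih hx.1) (abs_nonneg c)

theorem norm_exp_I_mul_sub_taylor_le (c : ℝ) (n : ℕ) {u : ℝ} (hu : |u| ≤ 1) :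
    ‖Complex.exp (Complex.I * c * u) -
        ∑ k ∈ Finset.range n, (Complex.I * c) ^ k / (k.factorial : ℂ) * (u : ℂ) ^ k‖ ≤
      |c| ^ n / n.factorial := by
  have h := norm_exp_I_mul_sub_sum_le (c * u) n zero_le_one
  have h1 : |c * u| ^ n ≤ |c| ^ n := by
    rw [abs_mul]
    exact pow_le_pow_left₀ (by positivity) (mul_le_of_le_one_right (abs_nonneg c) hu) n
  refine le_trans (le_of_eq ?_) (h.trans (by rw [one_pow, mul_one]; gcongr))
  congr 2
  · push_cast; ring_nf
  · refine Finset.sum_congr rfl fun k _ => ?_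
    push_cast; ring

/-- The error of the Gauss–Legendre rule for an oscillating exponential. -/
theorem norm_sum_legendreWeight_exp_sub_le {n : ℕ} (hn : 0 < n) (c : ℝ) :
    ‖∑ x ∈ legendreNodes n, (legendreWeight n x : ℂ) * Complex.exp (Complex.I * c * x) -
        ∫ t in (-1 : ℝ)..1, Complex.exp (Complex.I * c * t)‖ ≤
      4 * (|c| ^ (2 * n) / (2 * n).factorial) := by
  set τ := |c| ^ (2 * n) / ((2 * n).factorial : ℝ) with hτ
  set a : ℕ → ℂ := fun k => (Complex.I * c) ^ k / (k.factorial : ℂ) with ha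
  set p : ℝ → ℂ := fun t => ∑ k ∈ Finset.range (2 * n), a k * (t : ℂ) ^ k with hp
  have hpc : Continuous p := by fun_prop
  have hec : Continuous fun t : ℝ => Complex.exp (Complex.I * c * t) := by fun_prop
  have hexact : ∑ x ∈ legendreNodes n, (legendreWeight n x : ℂ) * p x =
      ∫ t in (-1 : ℝ)..1, p t := by
    simp only [hp, Finset.mul_sum]
    rw [Finset.sum_comm, intervalIntegral.integral_finsetSum]
    · refine Finset.sum_congr rfl fun k hk => ?_
      have h := sum_legendreWeight_mul_eval (n := n) (p := Polynomial.X ^ k)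
        (by simpa using Finset.mem_range.1 hk)
      simp only [Polynomial.eval_pow, Polynomial.eval_X] at h
      have h' : ∫ t in (-1 : ℝ)..1, (t : ℂ) ^ k = ((∫ t in (-1 : ℝ)..1, t ^ k : ℝ) : ℂ) := by
        rw [← intervalIntegral.integral_ofReal]; simp
      rw [intervalIntegral.integral_const_mul, h', ← h]
      push_cast
      rw [Finset.mul_sum]
      exact Finset.sum_congr rfl fun x _ => by ring
    · intro k _
      exact Continuous.intervalIntegrable (by fun_prop) _ _
  -- Rule and integral agree on the Taylor polynomial `p`. Each is then applied to a remainder of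
  -- size `τ` with total mass `2`, whence the factor `4`.
  have hsplit : ∑ x ∈ legendreNodes n, (legendreWeight n x : ℂ) * Complex.exp (Complex.I * c * x) -
        ∫ t in (-1 : ℝ)..1, Complex.exp (Complex.I * c * t) =
      ∑ x ∈ legendreNodes n, (legendreWeight n x : ℂ) * (Complex.exp (Complex.I * c * x) - p x) -
        ∫ t in (-1 : ℝ)..1, (Complex.exp (Complex.I * c * t) - p t) := by
    rw [intervalIntegral.integral_sub (hec.intervalIntegrable _ _) (hpc.intervalIntegrable _ _),
      ← hexact]
    simp only [mul_sub, Finset.sum_sub_distrib]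
    ring
  have h1 : ‖∑ x ∈ legendreNodes n,
      (legendreWeight n x : ℂ) * (Complex.exp (Complex.I * c * x) - p x)‖ ≤ 2 * τ := by
    rw [← sum_legendreWeight hn, Finset.sum_mul]
    refine norm_sum_le_of_le _ fun x hx => ?_
    have hx' := legendreNodes_mem_Ioo hx
    rw [norm_mul, Complex.norm_real, Real.norm_of_nonneg (legendreWeight_nonneg hx)]
    exact mul_le_mul_of_nonneg_left
      (norm_exp_I_mul_sub_taylor_le c _ (abs_le.2 ⟨hx'.1.le, hx'.2.le⟩)) (legendreWeight_nonneg hx)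
  have h2 : ‖∫ t in (-1 : ℝ)..1, (Complex.exp (Complex.I * c * t) - p t)‖ ≤ 2 * τ := by
    have := intervalIntegral.norm_integral_le_of_norm_le_const (a := (-1 : ℝ)) (b := 1)
      (C := τ) (f := fun t : ℝ => Complex.exp (Complex.I * c * t) - p t) fun t ht => by
        rw [Set.uIoc_of_le (by norm_num)] at ht
        exact norm_exp_I_mul_sub_taylor_le c _ (abs_le.2 ⟨ht.1.le, ht.2⟩)
    refine this.trans (le_of_eq ?_)
    norm_num [mul_comm]
  rw [hsplit]
  refine (norm_sub_le _ _).trans ?_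
  linarith

/-- From `m! ≥ (m / e) ^ m` and `e √2 ≤ 4`, the quotient is at most `(T / (T + L)) ^ m = (1 - L / (T
+ L)) ^ m`, and `1 - u ≤ exp (-u)` with `m ≥ 4 (T + L)` finishes. -/
theorem pow_div_factorial_le_exp_neg {T L c : ℝ} (hT : 0 < T) (hL : 0 ≤ L) (hc : 0 ≤ c)
    (hcT : c ≤ √2 * T) {m : ℕ} (hm : 4 * (T + L) ≤ m) :
    c ^ m / m.factorial ≤ Real.exp (-(4 * L)) := by
  have hm0 : (0 : ℝ) < m := lt_of_lt_of_le (by positivity) hm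
  have hfac : (0 : ℝ) < m.factorial := by positivity
  have h1 : (m : ℝ) ^ m / m.factorial ≤ Real.exp m := Real.pow_div_factorial_le_exp _ hm0.le _
  have h2 : c ^ m / m.factorial ≤ (Real.exp 1 * c / m) ^ m := by
    have h3 : Real.exp m = Real.exp 1 ^ m := by rw [← Real.exp_nat_mul, mul_one]
    rw [h3, div_le_iff₀ hfac] at h1
    rw [div_pow, mul_pow, div_le_div_iff₀ hfac (by positivity)]
    nlinarith [pow_nonneg hc m]
  refine h2.trans ?_
  have he : Real.exp 1 * √2 ≤ 4 := by
    have := Real.exp_one_lt_d9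
    have h2 : √2 ≤ 1.4143 := by
      rw [Real.sqrt_le_left (by norm_num)]; norm_num
    nlinarith [Real.sqrt_nonneg 2, Real.exp_pos 1]
  have h4 : Real.exp 1 * c / m ≤ Real.exp (-(L / (T + L))) := by
    have h5 : Real.exp 1 * c / m ≤ T / (T + L) := by
      rw [div_le_div_iff₀ hm0 (by positivity)]
      calc Real.exp 1 * c * (T + L) ≤ Real.exp 1 * (√2 * T) * (T + L) := by gcongr
        _ = (Real.exp 1 * √2) * (T * (T + L)) := by ring
        _ ≤ 4 * (T * (T + L)) := by gcongr
        _ = T * (4 * (T + L)) := by ring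
        _ ≤ T * m := by gcongr
    have h6 := Real.add_one_le_exp (-(L / (T + L)))
    have h7 : T / (T + L) = -(L / (T + L)) + 1 := by field_simp; ring
    linarith
  calc (Real.exp 1 * c / m) ^ m ≤ Real.exp (-(L / (T + L))) ^ m :=
        pow_le_pow_left₀ (by positivity) h4 m
    _ = Real.exp (m * (-(L / (T + L)))) := (Real.exp_nat_mul _ _).symm
    _ ≤ Real.exp (-(4 * L)) := by
        rw [Real.exp_le_exp]
        have h8 : 0 ≤ L / (T + L) := by positivity
        have h9 : 4 * (T + L) * (L / (T + L)) = 4 * L := by field_simp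
        nlinarith [mul_le_mul_of_nonneg_right hm h8]

/-! ### The trapezoidal rule for a Gaussian via Poisson summation -/

/-- Two geometric tails. It serves on both sides of Poisson summation: for the truncation with the
given `K`, and for the aliases with `K = 0`. -/
theorem norm_tsum_int_sub_sum_le {g : ℤ → ℂ} {C r : ℝ} (hr0 : 0 ≤ r) (hr1 : r < 1) (K : ℕ)
    (hpos : ∀ j : ℕ, ‖g (K + 1 + j : ℕ)‖ ≤ C * r ^ j)
    (hneg : ∀ j : ℕ, ‖g (-(K + 1 + j : ℕ))‖ ≤ C * r ^ j) :
    ‖∑' m, g m - ∑ l ∈ Finset.range (2 * K + 1), g ((l : ℤ) - K)‖ ≤ 2 * (C / (1 - r)) := by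
  have hgeom : HasSum (fun j : ℕ => C * r ^ j) (C / (1 - r)) := by
    rw [div_eq_mul_inv]; exact (hasSum_geometric_of_lt_one hr0 hr1).mul_left C
  have hpos' : ∀ j : ℕ, ‖g ((j + (K + 1) : ℕ) : ℤ)‖ ≤ C * r ^ j := fun j => by
    rw [add_comm j]; exact hpos j
  have hneg' : ∀ j : ℕ, ‖g (-(((j + K : ℕ) : ℤ) + 1))‖ ≤ C * r ^ j := fun j => by
    have := hneg j
    rwa [show ((K + 1 + j : ℕ) : ℤ) = ((j + K : ℕ) : ℤ) + 1 by push_cast; ring] at this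
  have hs1 : Summable fun n : ℕ => g n :=
    (summable_nat_add_iff (K + 1)).1 (Summable.of_norm_bounded hgeom.summable hpos')
  have hs2 : Summable fun n : ℕ => g (-((n : ℤ) + 1)) :=
    (summable_nat_add_iff (f := fun n : ℕ => g (-((n : ℤ) + 1))) K).1
      (Summable.of_norm_bounded hgeom.summable hneg')
  have htsum := tsum_of_nat_of_neg_add_one hs1 hs2
  have h1 := hs1.sum_add_tsum_nat_add (K + 1)
  have h2 := hs2.sum_add_tsum_nat_add K
  have hfin : ∑ l ∈ Finset.range (2 * K + 1), g ((l : ℤ) - K) =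
      ∑ i ∈ Finset.range (K + 1), g i + ∑ i ∈ Finset.range K, g (-((i : ℤ) + 1)) := by
    rw [show 2 * K + 1 = K + (K + 1) by ring, Finset.sum_range_add, add_comm]
    congr 1
    · exact Finset.sum_congr rfl fun i _ => by push_cast; ring_nf
    · rw [← Finset.sum_range_reflect]
      refine Finset.sum_congr rfl fun i hi => ?_
      have := Finset.mem_range.1 hi
      congr 1
      omega
  have hb1 := tsum_of_norm_bounded hgeom hpos'
  have hb2 := tsum_of_norm_bounded hgeom hneg'
  rw [htsum, hfin, ← h1, ← h2]
  calc _ = ‖(∑' j : ℕ, g ((j + (K + 1) : ℕ) : ℤ)) + ∑' j : ℕ, g (-(((j + K : ℕ) : ℤ) + 1))‖ := by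
        congr 1; ring
    _ ≤ C / (1 - r) + C / (1 - r) := (norm_add_le _ _).trans (add_le_add hb1 hb2)
    _ = 2 * (C / (1 - r)) := by ring

/-- Poisson summation for a modulated Gaussian, sampled with step `Δ`. -/
theorem tsum_gaussian_mul_exp {Δ : ℝ} (hΔ : 0 < Δ) (s : ℝ) :
    ∑' m : ℤ, ((Δ * Real.exp (-(m * Δ) ^ 2 / 2) : ℝ) : ℂ) *
        Complex.exp (Complex.I * ((m * Δ * s : ℝ) : ℂ)) =
      (√(2 * Real.pi) : ℂ) *
        ∑' m : ℤ, ((Real.exp (-(m * (2 * Real.pi / Δ) - s) ^ 2 / 2) : ℝ) : ℂ) := by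
  have hpi := Real.pi_pos
  have hΔ' : (Δ : ℂ) ≠ 0 := by exact_mod_cast hΔ.ne'
  have hpi' : (Real.pi : ℂ) ≠ 0 := by exact_mod_cast hpi.ne'
  -- Chosen so that `π a m² = (m Δ)² / 2`; the imaginary linear term passed to the theta identity
  -- encodes the modulation by `s`.
  set a : ℝ := Δ ^ 2 / (2 * Real.pi) with ha
  have ha0 : 0 < a := by positivity
  have h := Complex.tsum_exp_neg_quadratic (a := (a : ℂ)) (by simpa using ha0)
    (Complex.I * ((Δ * s / (2 * Real.pi) : ℝ) : ℂ))
  have hsqrt : (1 : ℂ) / (a : ℂ) ^ (1 / 2 : ℂ) = ((√(2 * Real.pi) / Δ : ℝ) : ℂ) := by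
    rw [show (1 / 2 : ℂ) = ((1 / 2 : ℝ) : ℂ) by push_cast; rfl, ← Complex.ofReal_cpow ha0.le,
      ← Real.sqrt_eq_rpow, ha, Real.sqrt_div (by positivity), Real.sqrt_sq hΔ.le]
    push_cast
    rw [one_div_div]
  rw [hsqrt] at h
  have hL : ∀ m : ℤ, ((Δ * Real.exp (-(m * Δ) ^ 2 / 2) : ℝ) : ℂ) *
        Complex.exp (Complex.I * ((m * Δ * s : ℝ) : ℂ)) =
      (Δ : ℂ) * Complex.exp (-Real.pi * a * m ^ 2 +
        2 * Real.pi * (Complex.I * ((Δ * s / (2 * Real.pi) : ℝ) : ℂ)) * m) := by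
    intro m
    rw [Complex.exp_add, ← mul_assoc]
    congr 2
    · push_cast
      congr 2
      rw [ha]; push_cast; field_simp
    · push_cast; field_simp
  have hR : ∀ m : ℤ, Complex.exp (-Real.pi / a *
      (m + Complex.I * (Complex.I * ((Δ * s / (2 * Real.pi) : ℝ) : ℂ))) ^ 2) =
      ((Real.exp (-(m * (2 * Real.pi / Δ) - s) ^ 2 / 2) : ℝ) : ℂ) := by
    intro m
    rw [Complex.ofReal_exp, ← mul_assoc, Complex.I_mul_I, ha]
    congr 1
    push_cast
    field_simp
    ring
  simp only [hL, tsum_mul_left]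
  rw [h]
  simp only [hR]
  push_cast
  rw [← mul_assoc, mul_div_cancel₀ _ hΔ']

/-- The error of the truncated trapezoidal rule for the Fourier transform of a Gaussian: the first
term bounds the truncation, the second one the aliasing. -/
theorem norm_sum_gaussian_mul_exp_sub_le {Δ s w : ℝ} (hΔ : 0 < Δ) {K : ℕ} (hK : 0 < K)
    (hw : 0 < w) (hsw : |s| + w ≤ 2 * Real.pi / Δ) :
    ‖∑ l ∈ Finset.range (2 * K + 1),
        ((Δ * Real.exp (-(((l : ℝ) - K) * Δ) ^ 2 / 2) : ℝ) : ℂ) *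
          Complex.exp (Complex.I * ((((l : ℝ) - K) * Δ * s : ℝ) : ℂ)) -
        ((√(2 * Real.pi) * Real.exp (-s ^ 2 / 2) : ℝ) : ℂ)‖ ≤
      2 * (Real.exp (-(K * Δ) ^ 2 / 2) / (K * Δ)) +
        √(2 * Real.pi) * (2 * (Real.exp (-w ^ 2 / 2) / (1 - Real.exp (-(w * (2 * Real.pi / Δ)))))) := by
  set P := 2 * Real.pi / Δ with hP
  have hP0 : 0 < P := by positivity
  set Y := K * Δ with hY
  have hY0 : 0 < Y := by positivity
  set g : ℤ → ℂ := fun m => ((Δ * Real.exp (-(m * Δ) ^ 2 / 2) : ℝ) : ℂ) *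
        Complex.exp (Complex.I * ((m * Δ * s : ℝ) : ℂ)) with hg
  set h : ℤ → ℂ := fun m => ((Real.exp (-(m * P - s) ^ 2 / 2) : ℝ) : ℂ) with hh
  have hgn : ∀ m : ℤ, ‖g m‖ = Δ * Real.exp (-(m * Δ) ^ 2 / 2) := by
    intro m
    rw [hg]
    simp only
    rw [norm_mul, Complex.norm_exp_I_mul_ofReal, mul_one, Complex.norm_real,
      Real.norm_of_nonneg (by positivity)]
  have hhn : ∀ m : ℤ, ‖h m‖ = Real.exp (-(m * P - s) ^ 2 / 2) := by
    intro m
    rw [hh]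
    simp only
    rw [Complex.norm_real, Real.norm_of_nonneg (by positivity)]
  have hgK : ∀ j : ℕ, Δ * Real.exp (-((K + 1 + j) * Δ) ^ 2 / 2) ≤
      (Δ * Real.exp (-Y ^ 2 / 2) * Real.exp (-(Y * Δ))) * Real.exp (-(Y * Δ)) ^ j := by
    intro j
    rw [mul_assoc, mul_assoc, ← Real.exp_nat_mul, ← Real.exp_add, ← Real.exp_add]
    refine mul_le_mul_of_nonneg_left (Real.exp_le_exp.2 ?_) hΔ.le
    have : (K + 1 + j) * Δ = Y + (1 + j) * Δ := by rw [hY]; ring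
    rw [this]
    nlinarith [sq_nonneg ((1 + j) * Δ)]
  -- The nearest alias centres `±P` are at distance at least `w` from `s`, and each further one adds
  -- `P`; half the cross term in the square already gives the ratio `exp (-(w P))`.
  have hhK : ∀ t : ℝ, ∀ j : ℕ, |t| = 1 + j → Real.exp (-(t * P - s) ^ 2 / 2) ≤
      Real.exp (-w ^ 2 / 2) * Real.exp (-(w * P)) ^ j := by
    intro t j ht
    rw [← Real.exp_nat_mul, ← Real.exp_add, Real.exp_le_exp]
    have h1 : w + j * P ≤ |t * P - s| := by
      have := abs_sub_abs_le_abs_sub (t * P) s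
      rw [abs_mul, ht, abs_of_pos hP0] at this
      linarith
    have h2 : (w + j * P) ^ 2 ≤ (t * P - s) ^ 2 := by
      rw [← sq_abs (t * P - s)]
      exact pow_le_pow_left₀ (by positivity) h1 2
    nlinarith [sq_nonneg ((j : ℝ) * P)]
  have hA := norm_tsum_int_sub_sum_le (g := g) (Real.exp_nonneg _)
    (Real.exp_lt_one_iff.2 (neg_lt_zero.2 (mul_pos hY0 hΔ))) K
    (fun j => by rw [hgn]; simpa using hgK j)
    (fun j => by
      rw [hgn]
      refine le_trans (le_of_eq ?_) (hgK j)
      push_cast; ring_nf)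
  have hB := norm_tsum_int_sub_sum_le (g := h) (Real.exp_nonneg _)
    (Real.exp_lt_one_iff.2 (neg_lt_zero.2 (mul_pos hw hP0))) 0
    (fun j => by
      rw [hhn]
      refine hhK _ j ?_
      push_cast; rw [abs_of_nonneg (by positivity)])
    (fun j => by
      rw [hhn]
      refine hhK _ j ?_
      push_cast; rw [abs_neg, abs_of_nonneg (by positivity)])
  have hpois : ∑' m, g m = (√(2 * Real.pi) : ℂ) * ∑' m, h m := tsum_gaussian_mul_exp hΔ s
  -- By `1 + u ≤ exp u` at `u = Y Δ`, the step `Δ` drops out of the truncation bound.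
  have hAle : Δ * Real.exp (-Y ^ 2 / 2) * Real.exp (-(Y * Δ)) / (1 - Real.exp (-(Y * Δ))) ≤
      Real.exp (-Y ^ 2 / 2) / Y := by
    have h1 : 0 < Y * Δ := mul_pos hY0 hΔ
    have h2 : Real.exp (-(Y * Δ)) < 1 := Real.exp_lt_one_iff.2 (by linarith)
    rw [div_le_div_iff₀ (by linarith) hY0]
    have h3 := Real.add_one_le_exp (Y * Δ)
    have h4 : Real.exp (-(Y * Δ)) * Real.exp (Y * Δ) = 1 := by rw [← Real.exp_add]; simp
    have h5 : Real.exp (-(Y * Δ)) * (Y * Δ) ≤ 1 - Real.exp (-(Y * Δ)) := by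
      nlinarith [Real.exp_pos (-(Y * Δ))]
    nlinarith [Real.exp_pos (-Y ^ 2 / 2)]
  have h0 : ∑ l ∈ Finset.range (2 * 0 + 1), h ((l : ℤ) - (0 : ℕ)) =
      ((Real.exp (-s ^ 2 / 2) : ℝ) : ℂ) := by
    simp [hh]
  rw [h0] at hB
  have hsum : ∑ l ∈ Finset.range (2 * K + 1),
        ((Δ * Real.exp (-(((l : ℝ) - K) * Δ) ^ 2 / 2) : ℝ) : ℂ) *
          Complex.exp (Complex.I * ((((l : ℝ) - K) * Δ * s : ℝ) : ℂ)) =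
      ∑ l ∈ Finset.range (2 * K + 1), g ((l : ℤ) - K) := by
    refine Finset.sum_congr rfl fun l _ => ?_
    rw [hg]; push_cast; rfl
  rw [hsum]
  calc _ = ‖(√(2 * Real.pi) : ℂ) * (∑' m, h m - ((Real.exp (-s ^ 2 / 2) : ℝ) : ℂ)) -
        (∑' m, g m - ∑ l ∈ Finset.range (2 * K + 1), g ((l : ℤ) - K))‖ := by
        rw [hpois]; congr 1; push_cast; ring
    _ ≤ √(2 * Real.pi) * (2 * (Real.exp (-w ^ 2 / 2) / (1 - Real.exp (-(w * P))))) +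
        2 * (Real.exp (-Y ^ 2 / 2) / Y) := by
        refine (norm_sub_le _ _).trans (add_le_add ?_ ?_)
        · rw [norm_mul, Complex.norm_real, Real.norm_of_nonneg (Real.sqrt_nonneg _)]
          exact mul_le_mul_of_nonneg_left hB (Real.sqrt_nonneg _)
        · exact hA.trans (by linarith)
    _ = _ := add_comm _ _

/-! ### The scalar error estimate -/

theorem norm_sum_qNode_exp_sub_le {n : ℕ} (hn : 0 < n) {Q : ℝ} (hQ : 0 ≤ Q) (b : ℝ) :
    ‖∑ x ∈ legendreNodes n, ((Q / 2 * legendreWeight n x : ℝ) : ℂ) *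
          Complex.exp (Complex.I * ((b * (Q * (1 + x) / 2) : ℝ) : ℂ)) -
        ∫ q in (0 : ℝ)..Q, Complex.exp (Complex.I * ((b * q : ℝ) : ℂ))‖ ≤
      2 * Q * (|b * Q / 2| ^ (2 * n) / (2 * n).factorial) := by
  set c := b * Q / 2 with hc
  have h := norm_sum_legendreWeight_exp_sub_le hn c
  have hsub := intervalIntegral.smul_integral_comp_mul_add (a := -1) (b := 1)
    (fun q : ℝ => Complex.exp (Complex.I * ((b * q : ℝ) : ℂ))) (Q / 2) (Q / 2)
  have hexp : ∀ t : ℝ, Complex.exp (Complex.I * ((b * (Q / 2 * t + Q / 2) : ℝ) : ℂ)) =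
      Complex.exp (Complex.I * c) * Complex.exp (Complex.I * c * t) := by
    intro t
    rw [← Complex.exp_add, hc]
    congr 1
    push_cast; ring
  rw [show Q / 2 * -1 + Q / 2 = 0 by ring, show Q / 2 * 1 + Q / 2 = Q by ring] at hsub
  simp only [hexp, intervalIntegral.integral_const_mul] at hsub
  have hsum : ∑ x ∈ legendreNodes n, ((Q / 2 * legendreWeight n x : ℝ) : ℂ) *
          Complex.exp (Complex.I * ((b * (Q * (1 + x) / 2) : ℝ) : ℂ)) =
      (Q / 2 : ℝ) • (Complex.exp (Complex.I * c) *
        ∑ x ∈ legendreNodes n, (legendreWeight n x : ℂ) * Complex.exp (Complex.I * c * x)) := by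
    rw [Finset.mul_sum, Finset.smul_sum]
    refine Finset.sum_congr rfl fun x _ => ?_
    rw [show b * (Q * (1 + x) / 2) = b * (Q / 2 * x + Q / 2) by ring, hexp, Complex.real_smul]
    push_cast; ring
  rw [hsum, ← hsub, ← smul_sub, ← mul_sub, norm_smul, norm_mul, Complex.norm_exp_I_mul_ofReal,
    one_mul, Real.norm_of_nonneg (by positivity)]
  calc _ ≤ Q / 2 * (4 * (|c| ^ (2 * n) / (2 * n).factorial)) := by gcongr
    _ = _ := by ring

/-- The full half-line integral is `π / |x|`. Shifting the tail by `Q` and using `(q + Q)² ≥ q² +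
Q²` bounds it by `exp (-(x Q)² / 2)` times that full integral. -/
theorem gaussian_integral_truncation {x d Q : ℝ} (hd : 0 < d) (hdx : d ≤ |x|) (hQ : 0 ≤ Q) :
    |Real.pi / |x| - ∫ q in (0 : ℝ)..Q, √(2 * Real.pi) * Real.exp (-(x * q) ^ 2 / 2)| ≤
      Real.pi / d * Real.exp (-(d * Q) ^ 2 / 2) := by
  have hx : 0 < |x| := hd.trans_le hdx
  have hx2 : 0 < x ^ 2 / 2 := by rw [← sq_abs]; positivity
  have hpi := Real.pi_pos
  set f : ℝ → ℝ := fun q => √(2 * Real.pi) * Real.exp (-(x * q) ^ 2 / 2) with hf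
  have hfeq : f = fun q => √(2 * Real.pi) * Real.exp (-(x ^ 2 / 2) * q ^ 2) := by
    rw [hf]; funext q; congr 2; ring
  have hint : MeasureTheory.Integrable f := by
    rw [hfeq]; exact (integrable_exp_neg_mul_sq hx2).const_mul _
  have htot : ∫ q in Set.Ioi (0 : ℝ), f q = Real.pi / |x| := by
    rw [hfeq, MeasureTheory.integral_const_mul, integral_gaussian_Ioi, mul_div_assoc',
      ← Real.sqrt_mul (by positivity),
      show 2 * Real.pi * (Real.pi / (x ^ 2 / 2)) = (2 * Real.pi / |x|) ^ 2 by
        rw [div_pow, sq_abs]; field_simp, Real.sqrt_sq (by positivity)]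
    ring
  have hsplit := intervalIntegral.integral_interval_add_Ioi (a := 0) (b := Q) (f := f)
    (μ := MeasureTheory.volume) hint.integrableOn hint.integrableOn
  rw [htot] at hsplit
  have hshift : ∫ q in Set.Ioi Q, f q = ∫ q in Set.Ioi (0 : ℝ), f (q + Q) := by
    rw [← (MeasureTheory.measurePreserving_add_right MeasureTheory.volume Q).setIntegral_preimage_emb
      (measurableEmbedding_addRight Q) f (Set.Ioi Q), Set.preimage_add_const_Ioi, sub_self]
  have hnonneg : 0 ≤ ∫ q in Set.Ioi Q, f q :=
    MeasureTheory.integral_nonneg fun q => by positivity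
  have hle : ∫ q in Set.Ioi Q, f q ≤ Real.exp (-(d * Q) ^ 2 / 2) * (Real.pi / |x|) := by
    rw [hshift, ← htot, ← MeasureTheory.integral_const_mul]
    refine MeasureTheory.setIntegral_mono_on (hint.comp_add_right Q).integrableOn
      (hint.const_mul _).integrableOn measurableSet_Ioi fun q hq => ?_
    simp only [hf]
    rw [mul_left_comm, ← Real.exp_add]
    refine mul_le_mul_of_nonneg_left (Real.exp_le_exp.2 ?_) (Real.sqrt_nonneg _)
    have h1 : (d * Q) ^ 2 ≤ (x * Q) ^ 2 := by
      rw [mul_pow, mul_pow, ← sq_abs x]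
      gcongr
    have h2 : 0 ≤ x ^ 2 * (q * Q) := mul_nonneg (sq_nonneg _) (mul_nonneg (le_of_lt hq) hQ)
    nlinarith
  have heq : Real.pi / |x| - ∫ q in (0 : ℝ)..Q, f q = ∫ q in Set.Ioi Q, f q := by
    rw [← hsplit]; ring
  rw [heq, abs_of_nonneg hnonneg]
  refine hle.trans ?_
  rw [mul_comm]
  gcongr

/-- The terms are, in order, the Gauss–Legendre error, the truncation in `y`, the aliasing and the
truncation in `q`, all multiplied by `π d`. With `h = exp (-L / 2) ≤ 1 / 2` they are at most
`1.061`, `2 √2`, `6.7` and `0.79` times `h²`, which sums to less than `4 π h²`. -/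
theorem error_budget_lt {L : ℝ} (hL : Real.log 4 ≤ L) :
    12 * √2 * L * Real.exp (-(4 * L)) +
      2 * √L * (2 * (Real.exp (-L) / √(2 * L)) + √(2 * Real.pi) *
        (2 * (Real.exp (-(9 / 4 * L)) / (3 / 4)))) + Real.pi * Real.exp (-(2 * L)) <
      4 * Real.pi * Real.exp (-L) := by
  have hlog4 : 0 < Real.log 4 := Real.log_pos (by norm_num)
  have hL0 : 0 < L := hlog4.trans_le hL
  set h := Real.exp (-(L / 2)) with hh
  have h0 : 0 < h := Real.exp_pos _
  have hE : Real.exp (-L) = h ^ 2 := by rw [hh, ← Real.exp_nat_mul]; congr 1; push_cast; ring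
  have hhalf : h ≤ 1 / 2 := by
    have h1 : Real.exp (-L) ≤ 1 / 4 := by
      calc Real.exp (-L) ≤ Real.exp (-Real.log 4) := Real.exp_le_exp.2 (by linarith)
        _ = 1 / 4 := by rw [Real.exp_neg, Real.exp_log (by norm_num)]; norm_num
    rw [hE] at h1
    nlinarith
  have hE4 : Real.exp (-(4 * L)) = h ^ 8 := by
    rw [hh, ← Real.exp_nat_mul]; congr 1; push_cast; ring
  have hE2 : Real.exp (-(2 * L)) = h ^ 4 := by
    rw [hh, ← Real.exp_nat_mul]; congr 1; push_cast; ring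
  have hE9 : Real.exp (-(9 / 4 * L)) ≤ h ^ 4 := by
    rw [← hE2]; exact Real.exp_le_exp.2 (by linarith)
  have hLh : L * h ^ 2 ≤ 1 := by
    rw [← hE, Real.exp_neg]
    rw [mul_inv_le_iff₀ (Real.exp_pos _)]
    linarith [Real.add_one_le_exp L]
  have hsq : √L * h ≤ 1 := by
    have h1 : (√L * h) ^ 2 ≤ 1 := by rw [mul_pow, Real.sq_sqrt hL0.le]; exact hLh
    nlinarith [Real.sqrt_nonneg L, mul_nonneg (Real.sqrt_nonneg L) h0.le]
  have hs2 : √2 ≤ 1.4143 := by rw [Real.sqrt_le_left (by norm_num)]; norm_num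
  have hs2' : 0 < √2 := by positivity
  have hpi1 := Real.pi_gt_d2
  have hpi2 := Real.pi_lt_d2
  have hs2pi : √(2 * Real.pi) ≤ 2.51 := by
    rw [Real.sqrt_le_left (by norm_num)]; nlinarith
  have hsl : √(2 * L) = √2 * √L := Real.sqrt_mul (by norm_num) _
  have hrL : 0 < √L := Real.sqrt_pos.2 hL0
  have hhsq : h ^ 2 ≤ 1 / 4 := by nlinarith
  have t1 : 12 * √2 * L * h ^ 8 ≤ 1.061 * h ^ 2 := by
    have e1 : 12 * √2 * L * h ^ 8 = 12 * √2 * (L * h ^ 2) * (h ^ 2 * h ^ 2) * h ^ 2 := by ring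
    rw [e1]
    have e2 : 12 * √2 * (L * h ^ 2) * (h ^ 2 * h ^ 2) ≤
        12 * 1.4143 * 1 * (1 / 4 * (1 / 4)) := by gcongr
    nlinarith [sq_nonneg h]
  have t2 : 2 * √L * (2 * (h ^ 2 / (√2 * √L))) = 2 * √2 * h ^ 2 := by
    field_simp
    rw [Real.sq_sqrt (by norm_num)]
  have t3 : 2 * √L * (√(2 * Real.pi) * (2 * (Real.exp (-(9 / 4 * L)) / (3 / 4)))) ≤
      6.7 * h ^ 2 := by
    have e1 : 2 * √L * (√(2 * Real.pi) * (2 * (Real.exp (-(9 / 4 * L)) / (3 / 4)))) ≤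
        2 * √L * (2.51 * (2 * (h ^ 4 / (3 / 4)))) := by gcongr
    refine e1.trans ?_
    have e2 : 2 * √L * (2.51 * (2 * (h ^ 4 / (3 / 4)))) =
      (16 / 3 * 2.51) * ((√L * h) * h) * h ^ 2 := by ring
    rw [e2]
    have e3 : (16 / 3 * 2.51) * ((√L * h) * h) ≤ (16 / 3 * 2.51) * (1 * (1 / 2)) := by gcongr
    nlinarith [sq_nonneg h]
  have t4 : Real.pi * h ^ 4 ≤ 0.79 * h ^ 2 := by
    have : Real.pi * h ^ 4 = Real.pi * h ^ 2 * h ^ 2 := by ring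
    rw [this]
    have : Real.pi * h ^ 2 ≤ 3.15 * (1 / 4) := by gcongr
    nlinarith [sq_nonneg h]
  rw [hE4, hE, hE2, hsl, mul_add, t2]
  have hh2 : 0 < h ^ 2 := by positivity
  nlinarith

theorem log_four_le {d ε : ℝ} (hd : 0 < d) (hε : 0 < ε) (hεd : ε ≤ 1 / d) :
    Real.log 4 ≤ Real.log (4 / (ε * d)) := by
  rw [le_div_iff₀ hd] at hεd
  refine Real.log_le_log (by norm_num) ?_
  rw [le_div_iff₀ (by positivity)]
  linarith

theorem yStep_odd (d ε : ℝ) (K : ℕ) : yStep d ε (2 * K + 1) = yMax d ε / K := by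
  rw [yStep]; push_cast
  rw [add_sub_cancel_right, mul_div_mul_left _ _ two_ne_zero]

theorem yNode_odd (d ε : ℝ) (K l : ℕ) :
    yNode d ε (2 * K + 1) l = ((l : ℝ) - K) * (yMax d ε / K) := by
  rw [yNode, yStep_odd]; push_cast
  rw [add_sub_cancel_right, mul_div_cancel_left₀ _ two_ne_zero]

theorem abs_yNode_le {d ε : ℝ} {K l : ℕ} (hK : 0 < K) (hl : l ∈ Finset.range (2 * K + 1)) :
    |yNode d ε (2 * K + 1) l| ≤ yMax d ε := by
  have hY : 0 ≤ yMax d ε := Real.sqrt_nonneg _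
  have hK' : (0 : ℝ) < K := by exact_mod_cast hK
  have hl' : (l : ℝ) ≤ 2 * K := by
    exact_mod_cast Nat.lt_succ_iff.1 (Finset.mem_range.1 hl)
  have h1 : |(l : ℝ) - K| ≤ K := abs_le.2 ⟨by linarith [(Nat.cast_nonneg l : (0 : ℝ) ≤ l)], by linarith⟩
  rw [yNode_odd, abs_mul, abs_of_nonneg (div_nonneg hY hK'.le)]
  calc _ ≤ K * (yMax d ε / K) := by gcongr
    _ = yMax d ε := by field_simp

/-- The error of the discretized integral for the scalar resolvent `1 / |x|`. -/
theorem norm_inv_abs_sub_sum_grid_lt {d D ε x : ℝ} {n K : ℕ} (hd : 0 < d) (hε : 0 < ε)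
    (hεd : ε ≤ 1 / d) (hdx : d ≤ |x|) (hxD : |x| ≤ D)
    (hn : 4 * (D / d * Real.log (4 / (ε * d)) + Real.log (4 / (ε * d))) ≤ 2 * n)
    (hK : 2 * √2 * (D / d) * Real.log (4 / (ε * d)) + 3 * Real.log (4 / (ε * d)) ≤
      2 * Real.pi * K) :
    ‖((1 / |x| : ℝ) : ℂ) - ∑ p ∈ grid n (2 * K + 1),
        ((1 / Real.pi * (yStep d ε (2 * K + 1) *
          Real.exp (-(yNode d ε (2 * K + 1) p.2) ^ 2 / 2)) *
          (qMax d ε / 2 * legendreWeight n p.1) : ℝ) : ℂ) *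
        Complex.exp (Complex.I * ((x * time d ε (2 * K + 1) p : ℝ) : ℂ))‖ < ε := by
  have hL4 := log_four_le hd hε hεd
  set L := Real.log (4 / (ε * d)) with hL
  have hlog4 : 0 < Real.log 4 := Real.log_pos (by norm_num)
  have hL0 : 0 < L := hlog4.trans_le hL4
  have hpi := Real.pi_pos
  have hD : 0 < D := hd.trans_le (hdx.trans hxD)
  have hEL : Real.exp (-L) = ε * d / 4 := by
    rw [Real.exp_neg, hL, Real.exp_log (by positivity), inv_div]
  set T := D / d * L with hT
  have hT0 : 0 < T := by positivity
  have hn0 : 0 < n := by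
    have : (0 : ℝ) < 2 * n := lt_of_lt_of_le (by positivity) hn
    exact_mod_cast (by linarith : (0 : ℝ) < n)
  have hK0 : (0 : ℝ) < K := by
    have : (0 : ℝ) < 2 * Real.pi * K := lt_of_lt_of_le (by positivity) hK
    exact pos_of_mul_pos_right this (by positivity)
  have hK1 : 0 < K := by exact_mod_cast hK0
  set Q := qMax d ε with hQ
  have hQe : Q = 2 / d * √L := rfl
  set Y := yMax d ε with hY
  have hYe : Y = √(2 * L) := rfl
  have hrL : 0 < √L := Real.sqrt_pos.2 hL0
  have hQ0 : 0 < Q := by rw [hQe]; positivity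
  have hY0 : 0 < Y := Real.sqrt_pos.2 (by positivity)
  have hY2 : Y ^ 2 = 2 * L := Real.sq_sqrt (by positivity)
  have hYs : Y = √2 * √L := Real.sqrt_mul (by norm_num) _
  have hLL : √L * √L = L := Real.mul_self_sqrt hL0.le
  have hYQ : Y * Q = 2 * √2 * L / d := by
    rw [hYs, hQe, show √2 * √L * (2 / d * √L) = 2 * √2 * (√L * √L) / d by ring, hLL]
  set Δ := Y / K with hΔ
  have hΔ0 : 0 < Δ := by positivity
  have hKΔ : K * Δ = Y := by rw [hΔ]; field_simp
  set y : ℕ → ℝ := fun l => ((l : ℝ) - K) * Δ with hy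
  have hynode : ∀ l, yNode d ε (2 * K + 1) l = y l := fun l => yNode_odd d ε K l
  set S : ℕ → ℝ := fun l => Δ * Real.exp (-(y l) ^ 2 / 2) with hS
  have hS0 : ∀ l, 0 ≤ S l := fun l => by positivity
  set G : ℕ → ℂ := fun l => ∑ u ∈ legendreNodes n, ((Q / 2 * legendreWeight n u : ℝ) : ℂ) *
          Complex.exp (Complex.I * ((x * y l * (Q * (1 + u) / 2) : ℝ) : ℂ)) with hG
  set J : ℕ → ℂ := fun l => ∫ q in (0 : ℝ)..Q,
    Complex.exp (Complex.I * ((x * y l * q : ℝ) : ℂ)) with hJ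
  have hsum : ∑ p ∈ grid n (2 * K + 1),
        ((1 / Real.pi * (yStep d ε (2 * K + 1) *
          Real.exp (-(yNode d ε (2 * K + 1) p.2) ^ 2 / 2)) *
          (Q / 2 * legendreWeight n p.1) : ℝ) : ℂ) *
        Complex.exp (Complex.I * ((x * time d ε (2 * K + 1) p : ℝ) : ℂ)) =
      ((1 / Real.pi : ℝ) : ℂ) * ∑ l ∈ Finset.range (2 * K + 1), (S l : ℂ) * G l := by
    rw [grid, Finset.sum_product_right, Finset.mul_sum]
    refine Finset.sum_congr rfl fun l _ => ?_
    rw [hG, Finset.mul_sum, Finset.mul_sum]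
    refine Finset.sum_congr rfl fun u _ => ?_
    rw [time, hynode, yStep_odd, qNode, hS,
      show x * (y l * (qMax d ε * (1 + u) / 2)) = x * y l * (Q * (1 + u) / 2) by rw [hQ]; ring]
    change ((1 / Real.pi * (Δ * _) * _ : ℝ) : ℂ) * _ = _
    push_cast
    ring
  -- the Gauss–Legendre rule in `q`
  have hGJ : ∀ l ∈ Finset.range (2 * K + 1), ‖G l - J l‖ ≤ 2 * Q * Real.exp (-(4 * L)) := by
    intro l hl
    refine (norm_sum_qNode_exp_sub_le hn0 hQ0.le (x * y l)).trans ?_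
    refine mul_le_mul_of_nonneg_left ?_ (by positivity)
    refine pow_div_factorial_le_exp_neg hT0 hL0.le (abs_nonneg _) ?_ (by exact_mod_cast hn)
    have hyl : |y l| ≤ Y := by rw [← hynode]; exact abs_yNode_le hK1 hl
    rw [abs_div, abs_mul, abs_mul, abs_of_pos hQ0, abs_of_pos (two_pos (α := ℝ))]
    calc |x| * |y l| * Q / 2 ≤ D * Y * Q / 2 := by gcongr
      _ = D * (Y * Q) / 2 := by ring
      _ = √2 * T := by rw [hYQ, hT]; ring
  -- All `2 K + 1` nodes carry the full weight `Δ`, so the mass is at most `2 Y + Δ`, and `Δ ≤ Y`.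
  have hSsum : ∑ l ∈ Finset.range (2 * K + 1), S l ≤ 3 * Y := by
    calc ∑ l ∈ Finset.range (2 * K + 1), S l ≤ ∑ l ∈ Finset.range (2 * K + 1), Δ := by
          refine Finset.sum_le_sum fun l _ => ?_
          refine mul_le_of_le_one_right hΔ0.le (Real.exp_le_one_iff.2 ?_)
          have := sq_nonneg (y l)
          linarith
      _ = 2 * (K * Δ) + Δ := by
          rw [Finset.sum_const, Finset.card_range, nsmul_eq_mul]; push_cast; ring
      _ ≤ 2 * Y + Y := by
          rw [hKΔ]
          have : Δ ≤ Y := div_le_self hY0.le (by exact_mod_cast hK1)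
          linarith
      _ = 3 * Y := by ring
  have e1 : ‖∑ l ∈ Finset.range (2 * K + 1), (S l : ℂ) * G l -
      ∑ l ∈ Finset.range (2 * K + 1), (S l : ℂ) * J l‖ ≤
      3 * Y * (2 * Q * Real.exp (-(4 * L))) := by
    rw [← Finset.sum_sub_distrib]
    calc _ ≤ ∑ l ∈ Finset.range (2 * K + 1), S l * (2 * Q * Real.exp (-(4 * L))) := by
          refine norm_sum_le_of_le _ fun l hl => ?_
          rw [← mul_sub, norm_mul, Complex.norm_real, Real.norm_of_nonneg (hS0 l)]
          exact mul_le_mul_of_nonneg_left (hGJ l hl) (hS0 l)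
      _ ≤ _ := by
          rw [← Finset.sum_mul]
          exact mul_le_mul_of_nonneg_right hSsum (by positivity)
  -- the trapezoidal rule in `y`
  set F : ℝ → ℂ := fun q => ∑ l ∈ Finset.range (2 * K + 1),
    (S l : ℂ) * Complex.exp (Complex.I * ((y l * (x * q) : ℝ) : ℂ)) with hF
  set g : ℝ → ℝ := fun q => √(2 * Real.pi) * Real.exp (-(x * q) ^ 2 / 2) with hg
  have hFint : ∑ l ∈ Finset.range (2 * K + 1), (S l : ℂ) * J l = ∫ q in (0 : ℝ)..Q, F q := by
    rw [hF, intervalIntegral.integral_finsetSum]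
    · refine Finset.sum_congr rfl fun l _ => ?_
      rw [intervalIntegral.integral_const_mul, hJ]
      simp only [show ∀ q, x * y l * q = y l * (x * q) from fun q => by ring]
    · intro l _
      exact Continuous.intervalIntegrable (by fun_prop) _ _
  -- The margin `w = 3 Y / 2` makes the aliases of size `exp (-9 L / 4)`, smaller than the
  -- truncation error `exp (-L)`. Multiplied by `Y`, the requirement `D Q + w ≤ 2 π / Δ` becomes
  -- hypothesis `hK`.
  have hw : 0 < 3 / 2 * Y := by positivity
  set P := 2 * Real.pi / Δ with hP
  have hPle : ∀ q ∈ Set.uIoc 0 Q, |x * q| + 3 / 2 * Y ≤ P := by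
    intro q hq
    rw [Set.uIoc_of_le hQ0.le] at hq
    have h1 : |x * q| ≤ D * Q := by
      rw [abs_mul, abs_of_pos hq.1]
      exact mul_le_mul hxD hq.2 hq.1.le hD.le
    have h2 : D * Q + 3 / 2 * Y ≤ P := by
      rw [hP, hΔ, div_div_eq_mul_div, le_div_iff₀ hY0]
      calc (D * Q + 3 / 2 * Y) * Y = D * (Y * Q) + 3 / 2 * Y ^ 2 := by ring
        _ = 2 * √2 * (D / d) * L + 3 * L := by rw [hYQ, hY2]; ring
        _ ≤ _ := hK
    linarith
  set η := 2 * (Real.exp (-L) / Y) +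
    √(2 * Real.pi) * (2 * (Real.exp (-(9 / 4 * L)) / (3 / 4))) with hη
  have hFg : ∀ q ∈ Set.uIoc 0 Q, ‖F q - ((g q : ℝ) : ℂ)‖ ≤ η := by
    intro q hq
    have h1 := norm_sum_gaussian_mul_exp_sub_le hΔ0 hK1 hw (hPle q hq)
    refine h1.trans ?_
    rw [hKΔ, hη, hY2, show -(2 * L) / 2 = -L by ring,
      show -(3 / 2 * Y) ^ 2 / 2 = -(9 / 4 * L) by rw [mul_pow, hY2]; ring]
    have h2 : Real.exp (-(3 / 2 * Y * (2 * Real.pi / Δ))) ≤ 1 / 4 := by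
      have h3 : L ≤ 3 / 2 * Y * (2 * Real.pi / Δ) := by
        have h4 := hPle q hq
        have h5 : 3 / 2 * Y * (3 / 2 * Y) ≤ 3 / 2 * Y * P :=
          mul_le_mul_of_nonneg_left (by linarith [abs_nonneg (x * q)]) hw.le
        nlinarith
      calc _ ≤ Real.exp (-Real.log 4) := Real.exp_le_exp.2 (by linarith)
        _ = 1 / 4 := by rw [Real.exp_neg, Real.exp_log (by norm_num)]; norm_num
    have h3 : (3 / 4 : ℝ) ≤ 1 - Real.exp (-(3 / 2 * Y * (2 * Real.pi / Δ))) := by linarith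
    gcongr
  have hgc : Continuous g := by fun_prop
  have hFc : Continuous F := by fun_prop
  have e2 : ‖(∫ q in (0 : ℝ)..Q, F q) - ((∫ q in (0 : ℝ)..Q, g q : ℝ) : ℂ)‖ ≤ Q * η := by
    rw [← intervalIntegral.integral_ofReal, ← intervalIntegral.integral_sub
      (hFc.intervalIntegrable _ _)
      (Continuous.intervalIntegrable (by fun_prop) _ _)]
    refine (intervalIntegral.norm_integral_le_of_norm_le_const hFg).trans (le_of_eq ?_)
    rw [sub_zero, abs_of_pos hQ0, mul_comm]
  -- truncation in `q`
  have e3 : ‖((Real.pi / |x| : ℝ) : ℂ) - ((∫ q in (0 : ℝ)..Q, g q : ℝ) : ℂ)‖ ≤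
      Real.pi / d * Real.exp (-(2 * L)) := by
    rw [← Complex.ofReal_sub, Complex.norm_real, Real.norm_eq_abs]
    refine (gaussian_integral_truncation hd hdx hQ0.le).trans (le_of_eq ?_)
    congr 2
    have : d * Q = 2 * √L := by rw [hQe]; field_simp
    rw [this, mul_pow, Real.sq_sqrt hL0.le]; ring
  have hbudget := error_budget_lt hL4
  have htotal : ‖((Real.pi / |x| : ℝ) : ℂ) -
      ∑ l ∈ Finset.range (2 * K + 1), (S l : ℂ) * G l‖ < Real.pi * ε := by
    calc _ = ‖(((Real.pi / |x| : ℝ) : ℂ) - ((∫ q in (0 : ℝ)..Q, g q : ℝ) : ℂ)) -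
          ((∫ q in (0 : ℝ)..Q, F q) - ((∫ q in (0 : ℝ)..Q, g q : ℝ) : ℂ)) -
          (∑ l ∈ Finset.range (2 * K + 1), (S l : ℂ) * G l -
            ∑ l ∈ Finset.range (2 * K + 1), (S l : ℂ) * J l)‖ := by
          rw [hFint]; congr 1; ring
      _ ≤ Real.pi / d * Real.exp (-(2 * L)) + Q * η + 3 * Y * (2 * Q * Real.exp (-(4 * L))) :=
          (norm_sub_le _ _).trans (add_le_add ((norm_sub_le _ _).trans (add_le_add e3 e2)) e1)
      _ = (12 * √2 * L * Real.exp (-(4 * L)) +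
            2 * √L * (2 * (Real.exp (-L) / √(2 * L)) + √(2 * Real.pi) *
            (2 * (Real.exp (-(9 / 4 * L)) / (3 / 4)))) + Real.pi * Real.exp (-(2 * L))) / d := by
          have : 3 * Y * (2 * Q * Real.exp (-(4 * L))) = 6 * (Y * Q) * Real.exp (-(4 * L)) := by
            ring
          rw [this, hYQ, hη, hQe, hYe]
          ring
      _ < 4 * Real.pi * Real.exp (-L) / d := by gcongr
      _ = Real.pi * ε := by rw [hEL]; field_simp
  rw [hsum]
  have hfac : ((1 / |x| : ℝ) : ℂ) - ((1 / Real.pi : ℝ) : ℂ) *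
      ∑ l ∈ Finset.range (2 * K + 1), (S l : ℂ) * G l =
      ((1 / Real.pi : ℝ) : ℂ) * (((Real.pi / |x| : ℝ) : ℂ) -
        ∑ l ∈ Finset.range (2 * K + 1), (S l : ℂ) * G l) := by
    rw [mul_sub, ← Complex.ofReal_mul]
    congr 3
    field_simp
  rw [hfac, norm_mul, Complex.norm_real, Real.norm_of_nonneg (by positivity), one_div,
    inv_mul_lt_iff₀ hpi]
  exact htotal

/-! ### Reduction of the operator error to the eigenvalues -/

section Spectral

variable {N : ℕ} {H : Matrix (Fin N) (Fin N) ℂ}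

/-- The matrix with the same eigenvectors as `H` and the eigenvalues `v`. -/
noncomputable def withEigenvalues (hH : H.IsHermitian) (v : Fin N → ℂ) :
    Matrix (Fin N) (Fin N) ℂ :=
  Unitary.conjStarAlgAut ℂ _ hH.eigenvectorUnitary (Matrix.diagonal v)

theorem norm_withEigenvalues (hH : H.IsHermitian) (v : Fin N → ℂ) :
    ‖withEigenvalues hH v‖ = ‖v‖ := by
  rw [withEigenvalues, Unitary.conjStarAlgAut_apply, ← Unitary.coe_star,
    CStarRing.norm_mul_coe_unitary, CStarRing.norm_coe_unitary_mul, Matrix.l2_opNorm_diagonal]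

theorem withEigenvalues_sub (hH : H.IsHermitian) (v w : Fin N → ℂ) :
    withEigenvalues hH v - withEigenvalues hH w = withEigenvalues hH (v - w) := by
  rw [withEigenvalues, withEigenvalues, withEigenvalues, ← map_sub, Matrix.diagonal_sub]
  rfl

theorem withEigenvalues_smul (hH : H.IsHermitian) (c : ℂ) (v : Fin N → ℂ) :
    c • withEigenvalues hH v = withEigenvalues hH (c • v) := by
  rw [withEigenvalues, withEigenvalues, ← map_smul, Matrix.diagonal_smul]

theorem withEigenvalues_sum (hH : H.IsHermitian) {ι : Type*} (s : Finset ι)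
    (v : ι → Fin N → ℂ) :
    ∑ i ∈ s, withEigenvalues hH (v i) = withEigenvalues hH (∑ i ∈ s, v i) := by
  simp only [withEigenvalues]
  rw [← map_sum]
  congr 1
  exact (map_sum (Matrix.diagonalAddMonoidHom (Fin N) ℂ) v s).symm

theorem eq_withEigenvalues (hH : H.IsHermitian) :
    H = withEigenvalues hH fun n => (hH.eigenvalues n : ℂ) :=
  hH.spectral_theorem

theorem resolventAt_eq_withEigenvalues (hH : H.IsHermitian) {a : ℝ}
    (ha : ∀ n, a - hH.eigenvalues n ≠ 0) :
    resolventAt H a =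
      withEigenvalues hH fun n => ((1 / (a - hH.eigenvalues n) : ℝ) : ℂ) := by
  rw [resolventAt]
  apply Matrix.inv_eq_right_inv
  have h1 : (a : ℂ) • (1 : Matrix (Fin N) (Fin N) ℂ) - H =
      withEigenvalues hH fun n => ((a - hH.eigenvalues n : ℝ) : ℂ) := by
    have : (1 : Matrix (Fin N) (Fin N) ℂ) = withEigenvalues hH 1 := by
      rw [withEigenvalues, show (Matrix.diagonal (1 : Fin N → ℂ)) = 1 from Matrix.diagonal_one,
        map_one]
    rw [this, withEigenvalues_smul]
    nth_rw 2 [eq_withEigenvalues hH]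
    rw [withEigenvalues_sub]
    congr 1
    funext n
    simp
  rw [h1, withEigenvalues, withEigenvalues, ← map_mul, Matrix.diagonal_mul_diagonal]
  have : (fun n => ((a - hH.eigenvalues n : ℝ) : ℂ) * ((1 / (a - hH.eigenvalues n) : ℝ) : ℂ)) =
      fun _ => 1 := by
    funext n
    rw [← Complex.ofReal_mul, mul_one_div_cancel (ha n), Complex.ofReal_one]
  rw [this, Matrix.diagonal_one, map_one]

theorem evolution_eq_withEigenvalues (hH : H.IsHermitian) (t : ℝ) :
    evolution H t =
      withEigenvalues hH fun n => Complex.exp (-(Complex.I * t) * hH.eigenvalues n) := by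
  rw [evolution]
  nth_rw 1 [eq_withEigenvalues hH]
  rw [withEigenvalues_smul, withEigenvalues, withEigenvalues, Unitary.conjStarAlgAut_apply,
    Unitary.conjStarAlgAut_apply]
  set U : Matrix (Fin N) (Fin N) ℂ := hH.eigenvectorUnitary.1
  have h1 : U * star U = 1 := Unitary.coe_mul_star_self hH.eigenvectorUnitary
  have h2 : star U = U⁻¹ := (Matrix.inv_eq_right_inv h1).symm
  have h3 : IsUnit U := ⟨⟨U, star U, h1, Unitary.coe_star_mul_self hH.eigenvectorUnitary⟩, rfl⟩
  rw [h2]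
  refine (Matrix.exp_conj U _ h3).trans ?_
  rw [Matrix.exp_diagonal]
  congr 3
  funext n
  rw [Pi.exp_def, ← Complex.exp_eq_exp_ℂ]
  simp

end Spectral

section Pole

variable {N : ℕ} {H : Matrix (Fin N) (Fin N) ℂ}

theorem minEig_le (hH : H.IsHermitian) (n : Fin N) : minEig hH ≤ hH.eigenvalues n :=
  ciInf_le (Set.finite_range _).bddBelow n

theorem le_maxEig (hH : H.IsHermitian) (n : Fin N) : hH.eigenvalues n ≤ maxEig hH :=
  le_ciSup (Set.finite_range _).bddAbove n

theorem aMinus_le (hH : H.IsHermitian) (a : ℝ) (n : Fin N) :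
    aMinus hH a ≤ |a - hH.eigenvalues n| :=
  ciInf_le (f := fun n => |a - hH.eigenvalues n|) (Set.finite_range _).bddBelow n

theorem le_aPlus (hH : H.IsHermitian) (a : ℝ) (n : Fin N) :
    |a - hH.eigenvalues n| ≤ aPlus hH a :=
  le_ciSup (f := fun n => |a - hH.eigenvalues n|) (Set.finite_range _).bddAbove n

theorem sign_sub_minEig (hH : H.IsHermitian) {a : ℝ}
    (ha : a ∉ Set.Icc (minEig hH) (maxEig hH)) (n : Fin N) :
    a - hH.eigenvalues n ≠ 0 ∧
      Real.sign (a - minEig hH) * |a - hH.eigenvalues n| = a - hH.eigenvalues n ∧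
      |Real.sign (a - minEig hH)| = 1 := by
  have h1 := minEig_le hH n
  have h2 := le_maxEig hH n
  rcases lt_or_ge a (minEig hH) with h | h
  · have h3 : a - hH.eigenvalues n < 0 := by linarith
    rw [Real.sign_of_neg (by linarith), abs_of_neg h3]
    exact ⟨h3.ne, by ring, by norm_num⟩
  · have h4 : maxEig hH < a := not_le.1 fun h' => ha ⟨h, h'⟩
    have h3 : 0 < a - hH.eigenvalues n := by linarith
    rw [Real.sign_of_pos (by linarith), abs_of_pos h3]
    exact ⟨h3.ne', by ring, by norm_num⟩

theorem aMinus_pos [NeZero N] (hH : H.IsHermitian) {a : ℝ}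
    (ha : a ∉ Set.Icc (minEig hH) (maxEig hH)) : 0 < aMinus hH a := by
  obtain ⟨n, hn⟩ := exists_eq_ciInf_of_finite (f := fun n => |a - hH.eigenvalues n|)
  rw [aMinus, ← hn]
  exact abs_pos.2 (sign_sub_minEig hH ha n).1

theorem aMinus_le_aPlus [NeZero N] (hH : H.IsHermitian) (a : ℝ) : aMinus hH a ≤ aPlus hH a :=
  (aMinus_le hH a 0).trans (le_aPlus hH a 0)

theorem norm_resolventAt_sub_lcu_lt [NeZero N] (hH : H.IsHermitian) {a : ℝ}
    (ha : a ∉ Set.Icc (minEig hH) (maxEig hH)) {ε : ℝ} (hε : 0 < ε) (hεa : ε ≤ 1 / aMinus hH a)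
    {n K : ℕ}
    (hn : 4 * (aPlus hH a / aMinus hH a * Real.log (4 / (ε * aMinus hH a)) +
      Real.log (4 / (ε * aMinus hH a))) ≤ 2 * n)
    (hK : 2 * √2 * (aPlus hH a / aMinus hH a) * Real.log (4 / (ε * aMinus hH a)) +
      3 * Real.log (4 / (ε * aMinus hH a)) ≤ 2 * Real.pi * K) :
    ‖resolventAt H a - lcu hH a ε n (2 * K + 1)‖ < ε := by
  have hd := aMinus_pos hH ha
  have hlcu : lcu hH a ε n (2 * K + 1) = withEigenvalues hH (∑ p ∈ grid n (2 * K + 1),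
      coeff hH a ε n (2 * K + 1) p • fun m =>
        Complex.exp (-(Complex.I * time (aMinus hH a) ε (2 * K + 1) p) * hH.eigenvalues m)) := by
    rw [← withEigenvalues_sum, lcu]
    exact Finset.sum_congr rfl fun p _ => by
      rw [evolution_eq_withEigenvalues hH, withEigenvalues_smul]
  rw [resolventAt_eq_withEigenvalues hH fun m => (sign_sub_minEig hH ha m).1, hlcu,
    withEigenvalues_sub, norm_withEigenvalues, pi_norm_lt_iff hε]
  intro m
  obtain ⟨hne, hsign, habs⟩ := sign_sub_minEig hH ha m
  set x := a - hH.eigenvalues m with hx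
  set σ := Real.sign (a - minEig hH) with hσ
  have hlt := norm_inv_abs_sub_sum_grid_lt hd hε hεa (aMinus_le hH a m) (le_aPlus hH a m) hn hK
  rw [← hx] at hlt
  refine lt_of_eq_of_lt ?_ hlt
  -- The sign `σ = ±1` is the same for all eigenvalues and `1 / x = σ / |x|`, so it factors out of
  -- the error without changing its norm.
  have hnorm : ∀ z : ℂ, ‖(σ : ℂ) * z‖ = ‖z‖ := fun z => by
    rw [norm_mul, Complex.norm_real, Real.norm_eq_abs, habs, one_mul]
  refine Eq.trans (congrArg _ ?_) (hnorm _)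
  have hσ2 : σ * σ = 1 := by rw [← abs_mul_abs_self, habs, one_mul]
  have hinv : (1 / x : ℝ) = σ * (1 / |x|) := by
    have : |x| = σ * x := by rw [← hsign, ← mul_assoc, hσ2, one_mul, abs_mul, abs_abs, habs, one_mul]
    have hx0 : |x| ≠ 0 := abs_ne_zero.2 hne
    field_simp
    linarith
  rw [Pi.sub_apply, Finset.sum_apply, mul_sub, Finset.mul_sum, ← hx, hinv, Complex.ofReal_mul]
  congr 1
  refine Finset.sum_congr rfl fun p _ => ?_
  have hexp : Complex.exp (Complex.I * ((x * time (aMinus hH a) ε (2 * K + 1) p : ℝ) : ℂ)) =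
      Complex.exp (Complex.I * ((a * time (aMinus hH a) ε (2 * K + 1) p : ℝ) : ℂ)) *
        Complex.exp (-(Complex.I * time (aMinus hH a) ε (2 * K + 1) p) * hH.eigenvalues m) := by
    rw [← Complex.exp_add]
    congr 1
    rw [hx]; push_cast; ring
  rw [hexp, Pi.smul_apply, smul_eq_mul, coeff]
  push_cast
  ring

end Pole

/-! ### Choice of the numbers of nodes within the budget `J` -/

/-- Half the number of steps of the trapezoidal rule: large enough to push the aliases of the
Gaussian out of the range of integration. -/
noncomputable def trapezoidHalf (ap am ε : ℝ) : ℕ :=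
  ⌈(2 * √2 * (ap / am) * Real.log (4 / (ε * am)) + 3 * Real.log (4 / (ε * am))) /
    (2 * Real.pi)⌉₊

/-- The number of Gauss–Legendre nodes: what the total cost leaves room for. -/
noncomputable def gaussOrder (ap am ε : ℝ) : ℕ :=
  ⌊costJ ap am ε / (2 * (trapezoidHalf ap am ε : ℝ) + 2)⌋₊

theorem le_two_pi_mul_trapezoidHalf (ap am ε : ℝ) :
    2 * √2 * (ap / am) * Real.log (4 / (ε * am)) + 3 * Real.log (4 / (ε * am)) ≤
      2 * Real.pi * trapezoidHalf ap am ε := by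
  have hpi := Real.pi_pos
  rw [mul_comm (2 * Real.pi), ← div_le_iff₀ (by positivity)]
  exact Nat.le_ceil _

/-- The Gauss–Legendre error needs `2 T + 2 L` nodes, where `T = κ L`; the extra `1` pays for the
floor in `gaussOrder`. Both factors of `J` are bounded below, and `2 K + 2` above, by affine
functions of `T` and `L`, so that two quadratic polynomials remain to be compared. -/
theorem costJ_ge {ap am ε : ℝ} (ham : 0 < am) (hap : am ≤ ap) (hε : 0 < ε) (hεa : ε ≤ 1 / am) :
    1 + 2 * (ap / am * Real.log (4 / (ε * am))) + 2 * Real.log (4 / (ε * am)) ≤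
      costJ ap am ε / (2 * (trapezoidHalf ap am ε : ℝ) + 2) := by
  have hL4 := log_four_le ham hε hεa
  set L := Real.log (4 / (ε * am)) with hL
  set κ := ap / am with hκ
  have hap0 : 0 < ap := ham.trans_le hap
  have hκ1 : 1 ≤ κ := (one_le_div ham).2 hap
  have hκ0 : 0 < κ := by linarith
  have hlog4 : Real.log 4 = 2 * Real.log 2 := by
    rw [show (4 : ℝ) = 2 ^ 2 by norm_num, Real.log_pow]; norm_num
  have hl2a := Real.log_two_gt_d9
  have hl2b := Real.log_two_lt_d9
  have hL0 : 1.386 ≤ L := by linarith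
  set T := κ * L with hT
  have hT0 : 0 ≤ T := by positivity
  have hpi1 := Real.pi_gt_d4
  have hpi0 := Real.pi_pos
  have hpi4 : Real.log Real.pi ≤ 2 * Real.log 2 := by
    rw [← hlog4]; exact Real.log_le_log hpi0 Real.pi_le_four
  have hs1 : (1.414 : ℝ) ≤ √2 := Real.le_sqrt_of_sq_le (by norm_num)
  have hs2 : √2 ≤ 1.4143 := by rw [Real.sqrt_le_left (by norm_num)]; norm_num
  have hLe : L = 2 * Real.log 2 - Real.log ε - Real.log am := by
    rw [hL, Real.log_div (by norm_num) (by positivity), Real.log_mul hε.ne' ham.ne', hlog4]; ring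
  have hlogκ : Real.log κ = Real.log ap - Real.log am := Real.log_div hap0.ne' ham.ne'
  -- The tangent of `log` at `4`, with `κ ≤ T / 1.386` from `L ≥ log 4`. It absorbs the `-log κ`
  -- left when the first factor of `J` is written in terms of `L`.
  have hlogκ_le : Real.log κ ≤ 0.1804 * T + 0.3863 := by
    have h1 := Real.log_le_sub_one_of_pos (show 0 < κ / 4 by positivity)
    rw [Real.log_div hκ0.ne' (by norm_num), hlog4] at h1
    have h2 : κ * 1.386 ≤ T := mul_le_mul_of_nonneg_left hL0 hκ0.le
    linarith
  have hA : 2.75 + 2 * L + 2.647 * T ≤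
      Real.log (32 * Real.exp Real.pi / (√Real.pi * ε ^ 2 * ap * am)) +
        2 * √2 * ap / am * L := by
    have h32 : Real.log 32 = 5 * Real.log 2 := by
      rw [show (32 : ℝ) = 2 ^ 5 by norm_num, Real.log_pow]; norm_num
    have hsp : √Real.pi ≠ 0 := (Real.sqrt_pos.2 hpi0).ne'
    rw [Real.log_div (by positivity) (by positivity), Real.log_mul (by norm_num) (by positivity),
      Real.log_exp, Real.log_mul (by positivity) ham.ne', Real.log_mul (by positivity) hap0.ne',
      Real.log_mul hsp (by positivity), Real.log_sqrt hpi0.le, Real.log_pow, h32]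
    have h1 : 2 * √2 * ap / am * L = 2 * √2 * T := by rw [hT, hκ]; ring
    have h2 : 2 * 1.414 * T ≤ 2 * √2 * T := by gcongr
    rw [h1]
    push_cast
    linarith
  have hB : 1.4426 * L + 0.7213 * T + 3.5 ≤
      Real.logb 2 (√2 / (Real.pi * ε * am)) + ap / (2 * am) * Real.logb 2 (4 / (ε * am)) + 7 := by
    have hl0 : 0 < Real.log 2 := by linarith
    have h1 : Real.log (√2 / (Real.pi * ε * am)) ≥ L - 3.5 * Real.log 2 := by
      rw [Real.log_div (by positivity) (by positivity), Real.log_mul (by positivity) ham.ne',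
        Real.log_mul hpi0.ne' hε.ne', Real.log_sqrt (by norm_num)]
      linarith
    have h2 : Real.logb 2 (√2 / (Real.pi * ε * am)) ≥ 1.4426 * L - 3.5 := by
      rw [Real.logb, ge_iff_le, le_div_iff₀ hl0]
      nlinarith
    have h3 : ap / (2 * am) * Real.logb 2 (4 / (ε * am)) ≥ 0.7213 * T := by
      have : ap / (2 * am) * Real.logb 2 (4 / (ε * am)) = T / 2 / Real.log 2 := by
        rw [Real.logb, ← hL, hT, hκ]; ring
      rw [this, ge_iff_le, le_div_iff₀ hl0]
      nlinarith
    linarith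
  have hM : 2 * (trapezoidHalf ap am ε : ℝ) + 2 ≤ 4 + 0.9004 * T + 0.955 * L := by
    have h1 := (Nat.ceil_lt_add_one (a := (2 * √2 * κ * L + 3 * L) / (2 * Real.pi))
      (by positivity)).le
    have h2 : (2 * √2 * κ * L + 3 * L) / (2 * Real.pi) ≤ (0.9004 * T + 0.955 * L) / 2 := by
      rw [div_le_iff₀ (by positivity)]
      have h3 : 2 * √2 * κ * L ≤ 2 * 1.4143 * T := by
        rw [hT, mul_assoc _ κ]; gcongr
      nlinarith
    change 2 * ((⌈(2 * √2 * κ * L + 3 * L) / (2 * Real.pi)⌉₊ : ℕ) : ℝ) + 2 ≤ _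
    linarith
  rw [le_div_iff₀ (by positivity)]
  calc (1 + 2 * T + 2 * L) * (2 * (trapezoidHalf ap am ε : ℝ) + 2)
      ≤ (1 + 2 * T + 2 * L) * (4 + 0.9004 * T + 0.955 * L) := by gcongr
    -- The inequality holds coefficient by coefficient in `T, L ≥ 0`; the tightest is `T²`, with
    -- about `1.80` against `1.91`.
    _ ≤ (2.75 + 2 * L + 2.647 * T) * (1.4426 * L + 0.7213 * T + 3.5) := by
        have hL0' : 0 ≤ L := by linarith
        nlinarith [mul_nonneg hT0 hL0', mul_nonneg hT0 hT0, mul_nonneg hL0' hL0']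
    _ ≤ _ := mul_le_mul hA hB (by positivity) (le_trans (by positivity) hA)

/-! ### Number of evolutions, maximal time and total time -/

theorem gridCard_eq (n Ly : ℕ) : gridCard n Ly = n * Ly := by
  rw [gridCard, grid, Finset.card_product, card_legendreNodes, Finset.card_range, Nat.cast_mul]

theorem yMax_mul_qMax {am ε : ℝ} (hL : 0 ≤ Real.log (4 / (ε * am))) :
    yMax am ε * qMax am ε = costTmax am ε := by
  rw [yMax, qMax, costTmax, Real.sqrt_mul (by norm_num)]
  have := Real.mul_self_sqrt hL
  linear_combination 2 * √2 / am * this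

theorem abs_time_le {am ε : ℝ} (ham : 0 < am) (hL : 0 ≤ Real.log (4 / (ε * am))) {n K : ℕ}
    (hK : 0 < K) {p : ℝ × ℕ} (hp : p ∈ grid n (2 * K + 1)) :
    |time am ε (2 * K + 1) p| ≤ costTmax am ε := by
  obtain ⟨hp1, hp2⟩ := Finset.mem_product.1 hp
  have hx := legendreNodes_mem_Ioo hp1
  have hQ : 0 ≤ qMax am ε := by rw [qMax]; positivity
  have hq0 : 0 ≤ qNode am ε p.1 := by
    rw [qNode]; exact div_nonneg (mul_nonneg hQ (by linarith [hx.1])) two_pos.le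
  have hq : qNode am ε p.1 ≤ qMax am ε := by
    rw [qNode, div_le_iff₀ two_pos]
    exact mul_le_mul_of_nonneg_left (by linarith [hx.2]) hQ
  rw [time, abs_mul, abs_of_nonneg hq0, ← yMax_mul_qMax hL]
  exact mul_le_mul (abs_yNode_le hK hp2) hq hq0 (Real.sqrt_nonneg _)

theorem timeSup_le {am ε : ℝ} (ham : 0 < am) (hL : 0 ≤ Real.log (4 / (ε * am))) {n K : ℕ}
    (hK : 0 < K) : timeSup am ε n (2 * K + 1) ≤ costTmax am ε := by
  have hT : 0 ≤ costTmax am ε := by rw [costTmax]; positivity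
  have h : ((grid n (2 * K + 1)).sup fun p => ‖time am ε (2 * K + 1) p‖₊) ≤
      (costTmax am ε).toNNReal :=
    Finset.sup_le fun p hp => NNReal.coe_le_coe.1 (by
      rw [Real.coe_toNNReal _ hT, coe_nnnorm, Real.norm_eq_abs]
      exact abs_time_le ham hL hK hp)
  exact (NNReal.coe_le_coe.2 h).trans_eq (Real.coe_toNNReal _ hT)

/-- The last trapezoidal node is exactly `yMax`, so only the largest Gauss node matters, and it
satisfies `(1 + x) / 2 ≥ (2 n) ^ (-1 / (2 n - 1))`. The exponent is written in the shape of
`tendsto_rpow_div_mul_add`. -/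
theorem timeSup_ge {am ε : ℝ} (ham : 0 < am) (hL : 0 ≤ Real.log (4 / (ε * am))) {n K : ℕ}
    (hK : 0 < K) (hn : 0 < n) :
    costTmax am ε * (2 * n : ℝ) ^ ((-1 : ℝ) / (1 * (2 * n : ℝ) + (-1))) ≤
      timeSup am ε n (2 * K + 1) := by
  obtain ⟨x, hx, hxn⟩ := exists_legendreNode_pow_ge hn
  have hx' := legendreNodes_mem_Ioo hx
  have hp : (x, 2 * K) ∈ grid n (2 * K + 1) :=
    Finset.mem_product.2 ⟨hx, Finset.mem_range.2 (Nat.lt_succ_self _)⟩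
  have hn' : (1 : ℝ) ≤ n := by exact_mod_cast hn
  have hz : (2 * n : ℝ) ^ ((-1 : ℝ) / (1 * (2 * n : ℝ) + (-1))) ≤ (1 + x) / 2 := by
    have hz0 : 0 ≤ (1 + x) / 2 := by linarith [hx'.1]
    have hm : (((2 * n - 1 : ℕ) : ℝ)) = 1 * (2 * n : ℝ) + (-1) := by
      rw [Nat.cast_sub (by omega)]; push_cast; ring
    rw [div_eq_mul_inv, Real.rpow_mul (by positivity), Real.rpow_neg_one, ← one_div, ← hm]
    refine (Real.rpow_le_rpow (by positivity) hxn (by positivity)).trans (le_of_eq ?_)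
    exact Real.pow_rpow_inv_natCast hz0 (by omega)
  have htime : costTmax am ε * ((1 + x) / 2) = |time am ε (2 * K + 1) (x, 2 * K)| := by
    have hK' : (K : ℝ) ≠ 0 := by exact_mod_cast hK.ne'
    have hQ : 0 ≤ qMax am ε := by rw [qMax]; positivity
    have hY : 0 ≤ yMax am ε := Real.sqrt_nonneg _
    rw [time, yNode_odd, qNode, ← yMax_mul_qMax hL]
    push_cast
    rw [show (2 * (K : ℝ) - K) * (yMax am ε / K) = yMax am ε by field_simp; ring,
      abs_of_nonneg (mul_nonneg hY (div_nonneg (mul_nonneg hQ (by linarith [hx'.1])) two_pos.le))]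
    ring
  have hT : 0 ≤ costTmax am ε := by rw [costTmax]; positivity
  calc _ ≤ costTmax am ε * ((1 + x) / 2) := mul_le_mul_of_nonneg_left hz hT
    _ = ((‖time am ε (2 * K + 1) (x, 2 * K)‖₊ : NNReal) : ℝ) := by
        rw [htime, coe_nnnorm, Real.norm_eq_abs]
    _ ≤ _ := NNReal.coe_le_coe.2
        (Finset.le_sup (f := fun p => ‖time am ε (2 * K + 1) p‖₊) hp)

theorem sum_abs_sub_range (K : ℕ) :
    ∑ l ∈ Finset.range (2 * K + 1), |(l : ℝ) - K| = K * (K + 1) := by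
  have hid : ∀ m : ℕ, ∑ i ∈ Finset.range m, (i : ℝ) = m * (m - 1) / 2 := by
    intro m
    induction m with
    | zero => simp
    | succ m ih => rw [Finset.sum_range_succ, ih]; push_cast; ring
  have h1 : ∑ i ∈ Finset.range K, |(i : ℝ) - K| = ∑ i ∈ Finset.range K, ((K : ℝ) - i) :=
    Finset.sum_congr rfl fun i hi => by
      have : (i : ℝ) ≤ K := by exact_mod_cast (Finset.mem_range.1 hi).le
      rw [abs_of_nonpos (by linarith)]; ring
  have h2 : ∀ i : ℕ, |((K + i : ℕ) : ℝ) - K| = i := fun i => by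
    push_cast
    rw [add_sub_cancel_left, abs_of_nonneg (Nat.cast_nonneg i)]
  rw [show 2 * K + 1 = K + (K + 1) by ring, Finset.sum_range_add, h1]
  simp only [h2]
  rw [Finset.sum_sub_distrib, hid, hid, Finset.sum_const, Finset.card_range, nsmul_eq_mul]
  push_cast
  ring

/-- The sum factors over the product grid. The Legendre nodes sum to zero, so the mean of `q` is
`qMax / 2`; the `|y|` sum to `(K + 1) yMax`. The resulting `2 K + 2`, not `Ly = 2 K + 1`, is why
`gaussOrder` divides by `2 K + 2`. -/
theorem timeSum_eq {am ε : ℝ} (ham : 0 < am) (hL : 0 ≤ Real.log (4 / (ε * am))) {K : ℕ} (n : ℕ)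
    (hK : 0 < K) :
    timeSum am ε n (2 * K + 1) = n * (2 * K + 2) * (costTmax am ε / 4) := by
  have hQ : 0 ≤ qMax am ε := by rw [qMax]; positivity
  have hY : 0 ≤ yMax am ε := Real.sqrt_nonneg _
  have hK' : (0 : ℝ) < K := by exact_mod_cast hK
  have hq : ∑ x ∈ legendreNodes n, |qNode am ε x| = n * (qMax am ε / 2) := by
    have h1 : ∀ x ∈ legendreNodes n, |qNode am ε x| = qMax am ε / 2 + qMax am ε / 2 * x := by
      intro x hx
      have hx' := legendreNodes_mem_Ioo hx
      rw [qNode, abs_of_nonneg (div_nonneg (mul_nonneg hQ (by linarith [hx'.1])) two_pos.le)]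
      ring
    rw [Finset.sum_congr rfl h1, Finset.sum_add_distrib, ← Finset.mul_sum, sum_legendreNodes,
      Finset.sum_const, card_legendreNodes, nsmul_eq_mul]
    ring
  have hy : ∑ l ∈ Finset.range (2 * K + 1), |yNode am ε (2 * K + 1) l| =
      (K + 1) * yMax am ε := by
    simp only [yNode_odd, abs_mul]
    rw [← Finset.sum_mul, sum_abs_sub_range, abs_of_nonneg (by positivity)]
    field_simp
  simp only [timeSum, grid, time, abs_mul]
  rw [Finset.sum_product, ← yMax_mul_qMax hL]
  simp only
  calc _ = ∑ x ∈ legendreNodes n, ((K + 1) * yMax am ε) * |qNode am ε x| :=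
        Finset.sum_congr rfl fun x _ => by rw [← Finset.sum_mul, hy]
    _ = _ := by rw [← Finset.mul_sum, hq]; ring

theorem costTtot_eq (ap am ε : ℝ) : costTtot ap am ε = costJ ap am ε * (costTmax am ε / 4) := by
  rw [costTtot, costTmax]; ring

theorem gaussOrder_mul_le {ap am ε : ℝ} (hJ : 0 ≤ costJ ap am ε) :
    (gaussOrder ap am ε : ℝ) * (2 * (trapezoidHalf ap am ε : ℝ) + 2) ≤ costJ ap am ε := by
  rw [← le_div_iff₀ (by positivity)]
  exact Nat.floor_le (by positivity)

/-! ### Sharpness of the cost bounds as the tolerance tends to zero -/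

theorem tendsto_log_four_div {am : ℝ} (ham : 0 < am) :
    Tendsto (fun ε => Real.log (4 / (ε * am))) (𝓝[>] 0) atTop := by
  have h : Tendsto (fun ε : ℝ => 4 / am * ε⁻¹) (𝓝[>] 0) atTop :=
    tendsto_inv_nhdsGT_zero.const_mul_atTop (by positivity)
  refine (Real.tendsto_log_atTop.comp h).congr fun ε => ?_
  simp only [Function.comp_apply]
  congr 1
  rw [mul_comm ε, ← div_div, div_eq_mul_inv (4 / am)]

theorem eventually_small {am : ℝ} (ham : 0 < am) : ∀ᶠ ε : ℝ in 𝓝[>] 0, 0 < ε ∧ ε ≤ 1 / am := by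
  filter_upwards [Ioc_mem_nhdsGT (show (0 : ℝ) < 1 / am by positivity)] with ε hε using hε

theorem tendsto_costJ_div {ap am : ℝ} (ham : 0 < am) (hap : am ≤ ap) :
    Tendsto (fun ε => costJ ap am ε / (2 * (trapezoidHalf ap am ε : ℝ) + 2)) (𝓝[>] 0) atTop := by
  refine tendsto_atTop_mono' _ ?_ (tendsto_log_four_div ham)
  filter_upwards [eventually_small ham] with ε hε
  have h1 := costJ_ge ham hap hε.1 hε.2
  have h2 : 0 < Real.log (4 / (ε * am)) :=
    (Real.log_pos (by norm_num)).trans_le (log_four_le ham hε.1 hε.2)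
  have h3 : 0 ≤ ap / am * Real.log (4 / (ε * am)) :=
    mul_nonneg (div_nonneg (ham.le.trans hap) ham.le) h2.le
  linarith

theorem tendsto_trapezoidHalf {ap am : ℝ} (ham : 0 < am) (hap : am ≤ ap) :
    Tendsto (fun ε => (trapezoidHalf ap am ε : ℝ)) (𝓝[>] 0) atTop := by
  have hpi := Real.pi_pos
  refine tendsto_atTop_mono' _ ?_
    ((tendsto_log_four_div ham).const_mul_atTop (show 0 < 3 / (2 * Real.pi) by positivity))
  filter_upwards [eventually_small ham] with ε hε
  have h1 := le_two_pi_mul_trapezoidHalf ap am ε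
  have h2 : 0 < Real.log (4 / (ε * am)) :=
    (Real.log_pos (by norm_num)).trans_le (log_four_le ham hε.1 hε.2)
  have h3 : 0 ≤ 2 * √2 * (ap / am) * Real.log (4 / (ε * am)) :=
    mul_nonneg (mul_nonneg (by positivity) (div_nonneg (ham.le.trans hap) ham.le)) h2.le
  rw [div_mul_eq_mul_div, div_le_iff₀ (by positivity)]
  linarith

theorem tendsto_gaussOrder_mul_div {ap am : ℝ} (ham : 0 < am) (hap : am ≤ ap) :
    Tendsto (fun ε => (gaussOrder ap am ε : ℝ) * (2 * (trapezoidHalf ap am ε : ℝ) + 2) /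
      costJ ap am ε) (𝓝[>] 0) (𝓝 1) := by
  refine ((tendsto_nat_floor_div_atTop (R := ℝ)).comp (tendsto_costJ_div ham hap)).congr
    fun ε => ?_
  simp only [Function.comp_apply, gaussOrder]
  rw [div_div_eq_mul_div]

theorem tendsto_gridCard_div {ap am : ℝ} (ham : 0 < am) (hap : am ≤ ap) :
    Tendsto (fun ε => gridCard (gaussOrder ap am ε) (2 * trapezoidHalf ap am ε + 1) /
      costJ ap am ε) (𝓝[>] 0) (𝓝 1) := by
  have h1 : Tendsto (fun ε => (2 * (trapezoidHalf ap am ε : ℝ) + 2)) (𝓝[>] 0) atTop :=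
    tendsto_atTop_add_const_right _ _ ((tendsto_trapezoidHalf ham hap).const_mul_atTop two_pos)
  -- This is the ratio `(2 K + 1) / (2 K + 2)` between the actual number of trapezoidal nodes and
  -- the divisor of the budget.
  have h2 : Tendsto (fun ε => 1 - (2 * (trapezoidHalf ap am ε : ℝ) + 2)⁻¹) (𝓝[>] 0) (𝓝 1) := by
    simpa using (tendsto_const_nhds (x := (1 : ℝ))).sub (tendsto_inv_atTop_zero.comp h1)
  have h3 := (tendsto_gaussOrder_mul_div ham hap).mul h2
  rw [one_mul] at h3
  refine h3.congr fun ε => ?_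
  rw [gridCard_eq]
  have : (2 * (trapezoidHalf ap am ε : ℝ) + 2) ≠ 0 := by positivity
  push_cast
  field_simp
  ring

theorem tendsto_timeSum_div {ap am : ℝ} (ham : 0 < am) (hap : am ≤ ap) :
    Tendsto (fun ε => timeSum am ε (gaussOrder ap am ε) (2 * trapezoidHalf ap am ε + 1) /
      costTtot ap am ε) (𝓝[>] 0) (𝓝 1) := by
  refine (tendsto_gaussOrder_mul_div ham hap).congr' ?_
  filter_upwards [(tendsto_trapezoidHalf ham hap).eventually_gt_atTop 0,
    (tendsto_log_four_div ham).eventually_gt_atTop 0] with ε hK hL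
  have hT : costTmax am ε / 4 ≠ 0 := by rw [costTmax]; positivity
  rw [timeSum_eq ham hL.le _ (by exact_mod_cast hK), costTtot_eq, mul_div_mul_right _ _ hT]

theorem tendsto_timeSup_div {ap am : ℝ} (ham : 0 < am) (hap : am ≤ ap) :
    Tendsto (fun ε => timeSup am ε (gaussOrder ap am ε) (2 * trapezoidHalf ap am ε + 1) /
      costTmax am ε) (𝓝[>] 0) (𝓝 1) := by
  have hn : Tendsto (fun ε => gaussOrder ap am ε) (𝓝[>] 0) atTop :=
    tendsto_nat_floor_atTop.comp (tendsto_costJ_div ham hap)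
  have h2n : Tendsto (fun ε => 2 * (gaussOrder ap am ε : ℝ)) (𝓝[>] 0) atTop :=
    (tendsto_natCast_atTop_atTop.comp hn).const_mul_atTop two_pos
  have hlow := (tendsto_rpow_div_mul_add (-1) 1 (-1) zero_ne_one).comp h2n
  refine tendsto_of_tendsto_of_tendsto_of_le_of_le' hlow tendsto_const_nhds ?_ ?_
  · filter_upwards [(tendsto_trapezoidHalf ham hap).eventually_gt_atTop 0,
      (tendsto_log_four_div ham).eventually_gt_atTop 0, hn.eventually_gt_atTop 0] with ε hK hL hn
    have hT : 0 < costTmax am ε := by rw [costTmax]; positivity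
    rw [le_div_iff₀ hT, mul_comm]
    exact timeSup_ge ham hL.le (by exact_mod_cast hK) hn
  · filter_upwards [(tendsto_trapezoidHalf ham hap).eventually_gt_atTop 0,
      (tendsto_log_four_div ham).eventually_gt_atTop 0] with ε hK hL
    have hT : 0 < costTmax am ε := by rw [costTmax]; positivity
    rw [div_le_one hT]
    exact timeSup_le ham hL.le (by exact_mod_cast hK)

end RealPoleLCU

/-! ### Assembly -/

theorem theorem2 :
    ∃ Lq Ly : ℝ → ℝ → ℝ → ℕ,
      ∀ (N : ℕ) [NeZero N] (H : Matrix (Fin N) (Fin N) ℂ) (hH : H.IsHermitian) (a : ℝ),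
        a ∉ Set.Icc (RealPoleLCU.minEig hH) (RealPoleLCU.maxEig hH) →
        ∀ ap am : ℝ, ap = RealPoleLCU.aPlus hH a → am = RealPoleLCU.aMinus hH a →
          -- accuracy and cost, for every tolerance
          (∀ ε : ℝ, 0 < ε → ε ≤ 1 / am →
            1 ≤ Lq ap am ε ∧ 2 ≤ Ly ap am ε ∧
            ‖RealPoleLCU.resolventAt H a
                - RealPoleLCU.lcu hH a ε (Lq ap am ε) (Ly ap am ε)‖ < ε ∧
            RealPoleLCU.gridCard (Lq ap am ε) (Ly ap am ε) ≤ RealPoleLCU.costJ ap am ε ∧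
            RealPoleLCU.timeSup am ε (Lq ap am ε) (Ly ap am ε) ≤ RealPoleLCU.costTmax am ε ∧
            RealPoleLCU.timeSum am ε (Lq ap am ε) (Ly ap am ε)
              ≤ RealPoleLCU.costTtot ap am ε) ∧
          -- the three bounds are attained to leading order as the tolerance tends to zero
          Tendsto (fun ε => RealPoleLCU.gridCard (Lq ap am ε) (Ly ap am ε)
              / RealPoleLCU.costJ ap am ε) (𝓝[>] 0) (𝓝 1) ∧
          Tendsto (fun ε => RealPoleLCU.timeSup am ε (Lq ap am ε) (Ly ap am ε)
              / RealPoleLCU.costTmax am ε) (𝓝[>] 0) (𝓝 1) ∧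
          Tendsto (fun ε => RealPoleLCU.timeSum am ε (Lq ap am ε) (Ly ap am ε)
              / RealPoleLCU.costTtot ap am ε) (𝓝[>] 0) (𝓝 1) := by
  refine ⟨RealPoleLCU.gaussOrder, fun ap am ε => 2 * RealPoleLCU.trapezoidHalf ap am ε + 1, ?_⟩
  rintro N _ H hH a ha ap am rfl rfl
  have ham := RealPoleLCU.aMinus_pos hH ha
  have hap := RealPoleLCU.aMinus_le_aPlus hH a
  refine ⟨fun ε hε hεa => ?_, RealPoleLCU.tendsto_gridCard_div ham hap,
    RealPoleLCU.tendsto_timeSup_div ham hap, RealPoleLCU.tendsto_timeSum_div ham hap⟩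
  set ap := RealPoleLCU.aPlus hH a
  set am := RealPoleLCU.aMinus hH a
  have hL : 0 < Real.log (4 / (ε * am)) :=
    (Real.log_pos (by norm_num)).trans_le (RealPoleLCU.log_four_le ham hε hεa)
  have hap0 : 0 < ap := ham.trans_le hap
  have hge := RealPoleLCU.costJ_ge ham hap hε hεa
  have hT : 0 < ap / am * Real.log (4 / (ε * am)) := by positivity
  have hJ : 0 ≤ RealPoleLCU.costJ ap am ε := by
    have h : 0 < RealPoleLCU.costJ ap am ε / (2 * (RealPoleLCU.trapezoidHalf ap am ε : ℝ) + 2) := by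
      linarith
    exact ((div_pos_iff_of_pos_right (by positivity)).1 h).le
  have hmul := RealPoleLCU.gaussOrder_mul_le hJ
  have hK2 := RealPoleLCU.le_two_pi_mul_trapezoidHalf ap am ε
  have hK0 : 0 < RealPoleLCU.trapezoidHalf ap am ε := Nat.ceil_pos.2 (by positivity)
  -- The floor loses less than the `1` provided by `costJ_ge`; multiplied by `4`, this is the
  -- condition on the Gauss order in the error estimate.
  have hn : ap / am * Real.log (4 / (ε * am)) + Real.log (4 / (ε * am)) ≤
      RealPoleLCU.gaussOrder ap am ε / 2 := by
    have := Nat.lt_floor_add_one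
      (RealPoleLCU.costJ ap am ε / (2 * (RealPoleLCU.trapezoidHalf ap am ε : ℝ) + 2))
    change _ < (RealPoleLCU.gaussOrder ap am ε : ℝ) + 1 at this
    linarith
  have hn1 : 1 ≤ RealPoleLCU.gaussOrder ap am ε := Nat.le_floor (by push_cast; linarith)
  refine ⟨hn1, by dsimp only; omega, RealPoleLCU.norm_resolventAt_sub_lcu_lt hH ha hε hεa (by linarith) hK2,
    ?_, RealPoleLCU.timeSup_le ham hL.le hK0, ?_⟩
  · rw [RealPoleLCU.gridCard_eq]
    refine le_trans ?_ hmul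
    push_cast
    gcongr
    norm_num
  · rw [RealPoleLCU.timeSum_eq ham hL.le _ hK0, RealPoleLCU.costTtot_eq]
    refine mul_le_mul_of_nonneg_right hmul ?_
    rw [RealPoleLCU.costTmax]
    positivity
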